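/- Setting. Consider a convex quadrilateral panel in the plane with vertices $a,c,d,b$ in counterclockwise order. From each vertex $v$ issue four creases with unit tangents $t_1^v,\dots,t_4^v$, numbered counterclockwise at $a,d$ and clockwise at $b,c$; the sides of the panel are $ac$ (along $t_1^a=-t_1^c$), $ab$ (along $t_2^a=-t_2^b$), $bd$ (along $t_1^b=-t_1^d$) and $cd$ (along $t_2^c=-t_2^d$). Kawasaki's condition is assumed: the consecutive sector angles $\angle(t_1^v,t_2^v),\angle(t_2^v,t_3^v),\angle(t_3^v,t_4^v),\angle(t_4^v,t_1^v)$ are $\alpha_v,\beta_v,\pi-\alpha_v,\pi-\beta_v$ with $\alpha_v,\beta_v\in(0,\pi)$; thus $\alpha_v$ is the angle of the panel at $v$ and $\alpha_d=2\pi-\alpha_a-\alpha_b-\alpha_c$. The panel is surrounded by eight further panels (one across each side, one at each corner). An origami deformation moves each of the nine panels by a rigid motion $x\mapsto Rx+b$, $R\in SO(3)$, $b\in\mathbb R^3$, so that adjacent panels agree on their common crease. The folding angle $\gamma\in[-\pi,\pi]$ of a crease with tangent $t$ is such that the deformation gradients on the two sides satisfy $R_{\mathrm{left}}=R_{\mathrm{right}}R_t(\gamma)$,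 where $R_t(\gamma)$ is the right-handed rotation about $t$ by $\gamma$ (valley: $\gamma\in(0,\pi)$; mountain: $\gamma\in(-\pi,0)$). Let $\gamma_1,\dots,\gamma_4$ be the folding angles at a vertex. The deformation is non-degenerate if $\sin\gamma_1\sin\gamma_2\sin\gamma_3\sin\gamma_4\neq0$ at each vertex. It follows the mountain-valley assignment $\sigma_v\in\{+,-\}$ at $v$ if $\operatorname{sign}\gamma_3=-\sigma_v\operatorname{sign}\gamma_1$ and $\operatorname{sign}\gamma_4=\sigma_v\operatorname{sign}\gamma_2$. The pattern can be folded as non-degenerate RFFQM (rigidly and flat-foldable quadrilateral mesh origami) along $(\sigma_a,\sigma_b,\sigma_c,\sigma_d)$ if there is a continuous one-parameter family of origami deformations, with continuous folding angles, from the flat state (all angles $0$) to the folded flat state (all angles $\pm\pi$), all of whose intermediate states are non-degenerate and follow $\sigma_v$ at each vertex $v$. For $\alpha,\beta\in(0,\pi)$ let $\mathcal{MV}(\alpha,\beta)$ be $\emptyset$ if $\alpha=\beta=\pi/2$, $\{-\}$ if $\alpha=\beta\neq\pi/2$, $\{+\}$ if $\alpha=\pi-\beta\ne\pi/2$, and $\{+,-\}$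 otherwise. For $\sigma\in\mathcal{MV}(\alpha,\beta)$ put $$\mu_2^{\sigma}(\alpha,\beta)=\frac{-\sigma+\cos\alpha\cos\beta+\sin\alpha\sin\beta}{\cos\beta-\sigma\cos\alpha},\qquad \mu_1^{-\sigma}(\alpha,\beta)=\mu_2^{-\sigma}(\alpha,\pi-\beta).$$ Theorem. Let $\alpha_a,\alpha_b,\alpha_c,\beta_a,\beta_b,\beta_c\in(0,\pi)$ with $\alpha_d:=2\pi-\alpha_a-\alpha_b-\alpha_c\in(0,\pi)$, let $(\alpha_v,\beta_v)\neq(\pi/2,\pi/2)$ and $\sigma_v\in\mathcal{MV}(\alpha_v,\beta_v)$ for $v=a,b,c$, and set $$\mu_{abc}=\mu_1^{-\sigma_a}(\alpha_a,\beta_a)\,\mu_2^{\sigma_b}(\alpha_b,\beta_b)\,\mu_2^{\sigma_c}(\alpha_c,\beta_c).$$ (i) If $|\mu_{abc}|=1$, then for no $\beta_d\in(0,\pi)$ and $\sigma_d\in\mathcal{MV}(\alpha_d,\beta_d)$ is there a crease pattern with these sector angles that can be folded as non-degenerate RFFQM along $(\sigma_a,\sigma_b,\sigma_c,\sigma_d)$.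 (ii) If $|\mu_{abc}|\neq1$, there is exactly one pair $(\beta_d,\sigma_d)$ with $\beta_d\in(0,\pi)$ and $\sigma_d\in\mathcal{MV}(\alpha_d,\beta_d)$ for which such a pattern exists, namely $$\sigma_d=-\operatorname{sign}(\mu_{abc}^2-1),\qquad \beta_d=\arccos\Big(\sigma_d\,\frac{2\mu_{abc}-(\mu_{abc}^2+1)\cos(\alpha_a+\alpha_b+\alpha_c)}{2\mu_{abc}\cos(\alpha_a+\alpha_b+\alpha_c)-(\mu_{abc}^2+1)}\Big).$$ For this pair, crease patterns with these sector angles exist, and every one of them (whatever its side lengths) can be folded as non-degenerate RFFQM along $(\sigma_a,\sigma_b,\sigma_c,\sigma_d)$. The folding is unique in the sense that two non-degenerate origami deformations of the pattern that follow these assignments and have the same folding angle at the side $ac$ differ by a rigid motion of space. -/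

import Mathlib

open Real Set Matrix

namespace Origami

/-- The four vertices of a quadrilateral panel. Its sides are `ac`, `ab`, `bd`, `cd`; in
counterclockwise order its corners are `a`, `c`, `d`, `b`. -/
inductive Vertex
  | a | b | c | d

/-- The function on the vertices with the four given values. -/
def Vertex.vals {X : Type} (xa xb xc xd : X) : Vertex → X
  | .a => xa
  | .b => xb
  | .c => xc
  | .d => xd

/-- The panel itself, the four panels across its sides, and the panel opposite to it at each of
its four vertices. -/
inductive Panel
  | inner
  | ac | bd | ab | cd
  | corner (v : Vertex)

/-- The other endpoint of the side along the first crease at `v`. -/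
def Vertex.nbr₁ : Vertex → Vertex
  | .a => .c
  | .c => .a
  | .b => .d
  | .d => .b

/-- The other endpoint of the side along the second crease at `v`. -/
def Vertex.nbr₂ : Vertex → Vertex
  | .a => .b
  | .b => .a
  | .c => .d
  | .d => .c

/-- The panel across the first crease at `v`. -/
def Vertex.across₁ : Vertex → Panel
  | .a => .ac
  | .c => .ac
  | .b => .bd
  | .d => .bd

/-- The panel across the second crease at `v`. -/
def Vertex.across₂ : Vertex → Panel
  | .a => .ab
  | .b => .ab
  | .c => .cd
  | .d => .cd

/-- The creases at `a` and `d` are numbered counterclockwise, those at `b` and `c` clockwise. -/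
def Vertex.orient : Vertex → ℝ
  | .a => 1
  | .b => -1
  | .c => -1
  | .d => 1

/-- The four panels around a vertex in the order of the creases: `panelAt v i` lies between the
creases `i` and `i + 1` (modulo 4), so crease `i` separates `panelAt v (i - 1)` from
`panelAt v i`. The creases `t₁, …, t₄` at a vertex have the indices `0, …, 3`. -/
def panelAt (v : Vertex) : Fin 4 → Panel :=
  ![.inner, v.across₂, .corner v, v.across₁]

/-- The unit vector of the horizontal plane in `ℝ³` with polar angle `θ`. -/
noncomputable def dir (θ : ℝ) : Fin 3 → ℝ := ![cos θ, sin θ, 0]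

/-- The rotation `t ⊗ t + cos γ (I - t ⊗ t) + sin γ (e₃ ⊗ t^⊥ - t^⊥ ⊗ e₃)`: right-handed, by the
angle `γ`, about the horizontal unit vector `t = dir θ`; here `t^⊥` is `t` turned
counterclockwise by a right angle. -/
noncomputable def foldRot (θ γ : ℝ) : Matrix (Fin 3) (Fin 3) ℝ :=
  let t : Fin 3 → ℝ := dir θ
  let tp : Fin 3 → ℝ := ![-sin θ, cos θ, 0]
  let e₃ : Fin 3 → ℝ := ![0, 0, 1]
  vecMulVec t t + cos γ • (1 - vecMulVec t t) + sin γ • (vecMulVec e₃ tp - vecMulVec tp e₃)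

/-- A flat crease pattern around one panel. At each vertex `v` four creases leave, in the
directions `dir (θ v i)` and with lengths `len v i`; the consecutive sector angles are
`α v`, `β v`, `π - α v` and `π - β v` (Kawasaki's condition), of which `α v` is the angle of the
panel itself. Creases 0 and 1 are sides of the panel. How far the surrounding panels extend beyond
their creases plays no role. -/
structure Pattern (α β : Vertex → ℝ) where
  x : Vertex → Fin 3 → ℝ
  θ : Vertex → Fin 4 → ℝ
  len : Vertex → Fin 4 → ℝ
  x_planar : ∀ v, x v 2 = 0
  len_pos : ∀ v i, 0 < len v i
  sector₁ : ∀ v, θ v 1 = θ v 0 + v.orient * α v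
  sector₂ : ∀ v, θ v 2 = θ v 1 + v.orient * β v
  sector₃ : ∀ v, θ v 3 = θ v 2 + v.orient * (π - α v)
  side₁ : ∀ v, x v.nbr₁ = x v + len v 0 • dir (θ v 0)
  side₂ : ∀ v, x v.nbr₂ = x v + len v 1 • dir (θ v 1)

namespace Pattern

variable {α β : Vertex → ℝ}

/-- The `i`-th crease at `v`, as a set. -/
def crease (P : Pattern α β) (v : Vertex) (i : Fin 4) : Set (Fin 3 → ℝ) :=
  segment ℝ (P.x v) (P.x v + P.len v i • dir (P.θ v i))

/-- Origami deformations: each panel `p` is moved by the rigid motion `y ↦ R p y + b p`, and the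
resulting deformation is continuous, i.e. adjacent panels agree along their common crease. -/
def IsOrigami (P : Pattern α β) (R : Panel → Matrix (Fin 3) (Fin 3) ℝ)
    (b : Panel → Fin 3 → ℝ) : Prop :=
  (∀ p, R p ∈ Matrix.specialOrthogonalGroup (Fin 3) ℝ) ∧
  ∀ v i, ∀ y ∈ P.crease v i,
    R (panelAt v (i - 1)) *ᵥ y + b (panelAt v (i - 1)) = R (panelAt v i) *ᵥ y + b (panelAt v i)

/-- `γ v i ∈ [-π, π]` is the folding angle of the `i`-th crease at `v`, positive for a valley and
negative for a mountain: crossing the crease counterclockwise about `v` multiplies the deformation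
gradient from the right by the rotation about the crease with angle `γ v i`. -/
def IsFoldingAngles (P : Pattern α β) (R : Panel → Matrix (Fin 3) (Fin 3) ℝ)
    (γ : Vertex → Fin 4 → ℝ) : Prop :=
  ∀ v i, γ v i ∈ Icc (-π) π ∧
    R (panelAt v i) = R (panelAt v (i - 1)) * foldRot (P.θ v i) (v.orient * γ v i)

end Pattern

/-- At every vertex all four creases are properly folded. -/
def Nondegenerate (γ : Vertex → Fin 4 → ℝ) : Prop :=
  ∀ v, sin (γ v 0) * sin (γ v 1) * sin (γ v 2) * sin (γ v 3) ≠ 0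

/-- The mountains and valleys are those of the assignment `σ v = ±` at every vertex `v`: for `σ v = +`
the creases `t₁, t₃` are of opposite type and `t₂, t₄` of the same type, and the other way
round for `σ v = -`. -/
def FollowsAssignment (σ : Vertex → SignType) (γ : Vertex → Fin 4 → ℝ) : Prop :=
  ∀ v, SignType.sign (γ v 2) = -σ v * SignType.sign (γ v 0) ∧
    SignType.sign (γ v 3) = σ v * SignType.sign (γ v 1)

namespace Pattern

variable {α β : Vertex → ℝ}

/-- The pattern can be folded rigidly from flat to folded flat, along the mountain-valley
assignments `σ`: there is a continuous one-parameter family of origami deformations, with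
continuous folding angles, that starts flat (all angles `0`), ends folded flat
(all angles `±π`), and in between is non-degenerate and follows `σ`. -/
def FoldsAlong (P : Pattern α β) (σ : Vertex → SignType) : Prop :=
  ∃ (R : ℝ → Panel → Matrix (Fin 3) (Fin 3) ℝ) (b : ℝ → Panel → Fin 3 → ℝ)
    (γ : ℝ → Vertex → Fin 4 → ℝ),
    ContinuousOn R (Icc 0 1) ∧ ContinuousOn b (Icc 0 1) ∧ ContinuousOn γ (Icc 0 1) ∧
    (∀ s ∈ Icc (0 : ℝ) 1, P.IsOrigami (R s) (b s) ∧ P.IsFoldingAngles (R s) (γ s)) ∧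
    (∀ v i, γ 0 v i = 0) ∧ (∀ v i, |γ 1 v i| = π) ∧
    ∀ s ∈ Ioo (0 : ℝ) 1, Nondegenerate (γ s) ∧ FollowsAssignment σ (γ s)

/-- The folding along `σ` has one degree of freedom: two non-degenerate origami deformations that
follow `σ` and have the same folding angle at the side `ac` differ by a rigid motion of space. -/
def UniqueAlong (P : Pattern α β) (σ : Vertex → SignType) : Prop :=
  ∀ (R R' : Panel → Matrix (Fin 3) (Fin 3) ℝ) (b b' : Panel → Fin 3 → ℝ)
    (γ γ' : Vertex → Fin 4 → ℝ),
    P.IsOrigami R b → P.IsFoldingAngles R γ → Nondegenerate γ → FollowsAssignment σ γ →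
    P.IsOrigami R' b' → P.IsFoldingAngles R' γ' → Nondegenerate γ' → FollowsAssignment σ γ' →
    γ .a 0 = γ' .a 0 →
    ∃ Q ∈ Matrix.specialOrthogonalGroup (Fin 3) ℝ, ∃ c : Fin 3 → ℝ,
      ∀ p, R' p = Q * R p ∧ b' p = Q *ᵥ b p + c

end Pattern

open Classical in
/-- The set of mountain-valley assignments available at a vertex with sector angles `α, β`. -/
noncomputable def MV (α β : ℝ) : Set SignType :=
  if α = π / 2 ∧ β = π / 2 then ∅
  else if α = β then {-1}
  else if α = π - β then {1}
  else {1, -1}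

/-- The fold angle multiplier `μ₂^σ(α, β)`. -/
noncomputable def mu₂ (σ : SignType) (α β : ℝ) : ℝ :=
  (-(σ : ℝ) + cos α * cos β + sin α * sin β) / (cos β - (σ : ℝ) * cos α)

/-- The fold angle multiplier `μ₁^τ(α, β) = μ₂^τ(α, π - β)` (used with `τ = -σ`). -/
noncomputable def mu₁ (τ : SignType) (α β : ℝ) : ℝ := mu₂ τ α (π - β)

end Origami

/-! At a single vertex, the folds about the four creases must multiply to the identity. Written with
unit quaternions, this splits into equations in the half angles. With Kawasaki's condition, the
cosines of the half angles of opposite creases agree, so opposite angles agree up to sign, and an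
assignment `σ` fixes the signs: `γ₃ = -σ γ₁`, `γ₄ = σ γ₂`. What remains is one linear relation `tan
(γ₁/2) = -μ₂ tan (γ₂/2)` with a constant, nonzero `μ₂` (`half_angles_of_assignment`); conversely,
this relation makes the vertex close (`closed_of_half_angles`).

Writing `m v` for the multiplier `μ₂` at `v`, the common angles on the four sides of the panel force
`m a * m d = m b * m c` (`IsFoldingAngles.compatible`). Conversely, under this equation all
half-angle tangents can be taken as constant multiples of one parameter running from `0` to `∞`,
which gives the whole folding (`foldsAlong`). The side lengths never enter, because each rotation
fixes the direction of its crease.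

Since `μ₁` is the inverse of `μ₂` (`mu₁_neg_eq_inv`), the condition says that the multiplier at `d`
is `μ_abc`. For fixed `α_d`, the multiplier determines `σ_d` and `β_d` and never has absolute value
`1` (`eq_of_mu₂`), and every other nonzero value is attained (`exists_mu₂_eq`). Patterns exist
because a quadrilateral with the given angles can be circumscribed about a circle
(`nonempty_pattern`). Uniqueness holds because one angle determines all the others around the panel
(`uniqueAlong`). -/

namespace Origami

/-! ### Fold rotations as unit quaternions. -/

/-- The rotation matrix of the quaternion `w + x i + y j + z k`. -/
def quatMat (w x y z : ℝ) : Matrix (Fin 3) (Fin 3) ℝ :=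
  !![w ^ 2 + x ^ 2 - y ^ 2 - z ^ 2, 2 * (x * y - w * z), 2 * (x * z + w * y);
    2 * (x * y + w * z), w ^ 2 - x ^ 2 + y ^ 2 - z ^ 2, 2 * (y * z - w * x);
    2 * (x * z - w * y), 2 * (y * z + w * x), w ^ 2 - x ^ 2 - y ^ 2 + z ^ 2]

theorem quatMat_mul (w x y z w' x' y' z' : ℝ) :
    quatMat w x y z * quatMat w' x' y' z' =
      quatMat (w * w' - x * x' - y * y' - z * z') (w * x' + x * w' + y * z' - z * y')
        (w * y' - x * z' + y * w' + z * x') (w * z' + x * y' - y * x' + z * w') := by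
  ext i j
  fin_cases i <;> fin_cases j <;> simp [quatMat, Matrix.mul_apply, Fin.sum_univ_three] <;> ring

theorem quatMat_transpose (w x y z : ℝ) :
    (quatMat w x y z)ᵀ = quatMat w (-x) (-y) (-z) := by
  ext i j
  fin_cases i <;> fin_cases j <;> simp [quatMat] <;> ring

theorem quatMat_one : quatMat 1 0 0 0 = 1 := by
  ext i j
  fin_cases i <;> fin_cases j <;> simp [quatMat]

theorem quatMat_mul_transpose {w x y z : ℝ} (h : w ^ 2 + x ^ 2 + y ^ 2 + z ^ 2 = 1) :
    quatMat w x y z * (quatMat w x y z)ᵀ = 1 := by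
  rw [quatMat_transpose, quatMat_mul, ← quatMat_one]
  congr 1
  · linear_combination h
  all_goals ring

theorem quatMat_det (w x y z : ℝ) :
    (quatMat w x y z).det = (w ^ 2 + x ^ 2 + y ^ 2 + z ^ 2) ^ 3 := by
  rw [Matrix.det_fin_three]
  simp [quatMat]
  ring

theorem foldRot_eq_of (θ γ : ℝ) :
    foldRot θ γ =
      !![cos θ ^ 2 + cos γ * sin θ ^ 2, (1 - cos γ) * (cos θ * sin θ), sin γ * sin θ;
        (1 - cos γ) * (cos θ * sin θ), sin θ ^ 2 + cos γ * cos θ ^ 2, -(sin γ * cos θ);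
        -(sin γ * sin θ), sin γ * cos θ, cos γ] := by
  have h3 := sin_sq_add_cos_sq θ
  ext i j
  fin_cases i <;> fin_cases j <;>
    simp [foldRot, dir, Matrix.add_apply, Matrix.sub_apply, Matrix.smul_apply,
      Matrix.one_apply] <;> grind

theorem foldRot_eq_quatMat (θ γ : ℝ) :
    foldRot θ γ = quatMat (cos (γ / 2)) (sin (γ / 2) * cos θ) (sin (γ / 2) * sin θ) 0 := by
  have h1 : cos γ = cos (γ / 2) ^ 2 - sin (γ / 2) ^ 2 := by
    rw [← cos_two_mul']; congr 1; ring
  have h2 : sin γ = 2 * sin (γ / 2) * cos (γ / 2) := by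
    rw [← sin_two_mul]; congr 1; ring
  have h3 := sin_sq_add_cos_sq θ
  have h4 := sin_sq_add_cos_sq (γ / 2)
  ext i j
  fin_cases i <;> fin_cases j <;>
    simp [foldRot_eq_of, quatMat, h1, h2] <;> grind

theorem foldRot_norm (θ γ : ℝ) :
    cos (γ / 2) ^ 2 + (sin (γ / 2) * cos θ) ^ 2 + (sin (γ / 2) * sin θ) ^ 2 + 0 ^ 2 = 1 := by
  linear_combination sin (γ / 2) ^ 2 * sin_sq_add_cos_sq θ + sin_sq_add_cos_sq (γ / 2)

theorem foldRot_mul_transpose (θ γ : ℝ) : foldRot θ γ * (foldRot θ γ)ᵀ = 1 := by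
  rw [foldRot_eq_quatMat]
  exact quatMat_mul_transpose (foldRot_norm θ γ)

theorem foldRot_mem (θ γ : ℝ) : foldRot θ γ ∈ specialOrthogonalGroup (Fin 3) ℝ := by
  rw [mem_specialOrthogonalGroup_iff, mem_orthogonalGroup_iff]
  refine ⟨foldRot_mul_transpose θ γ, ?_⟩
  rw [foldRot_eq_quatMat, quatMat_det, foldRot_norm, one_pow]

theorem foldRot_neg (θ γ : ℝ) : foldRot θ (-γ) = (foldRot θ γ)ᵀ := by
  rw [foldRot_eq_quatMat, foldRot_eq_quatMat, quatMat_transpose, neg_div, cos_neg, sin_neg]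
  simp

theorem foldRot_neg_mul (θ γ : ℝ) : foldRot θ (-γ) * foldRot θ γ = 1 := by
  rw [foldRot_neg]
  exact mul_eq_one_comm.1 (foldRot_mul_transpose θ γ)

theorem foldRot_mulVec_dir (θ γ : ℝ) : foldRot θ γ *ᵥ dir θ = dir θ := by
  have h3 := sin_sq_add_cos_sq θ
  ext i
  fin_cases i <;>
    simp [foldRot_eq_of, dir, Matrix.mulVec, dotProduct, Fin.sum_univ_three] <;> grind

/-- Folding about the opposite tangent by the opposite angle. -/
theorem foldRot_eq_of_dir_eq_neg {θ θ' : ℝ} (h : dir θ' = -dir θ) (γ : ℝ) :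
    foldRot θ' (-γ) = foldRot θ γ := by
  have hc : cos θ' = -cos θ := by simpa [dir] using congrFun h 0
  have hs : sin θ' = -sin θ := by simpa [dir] using congrFun h 1
  rw [foldRot_eq_quatMat, foldRot_eq_quatMat, hc, hs, neg_div, cos_neg, sin_neg]
  simp

theorem foldRot_injective {θ γ γ' : ℝ} (hγ : γ ∈ Ioo (-π) π) (hγ' : γ' ∈ Ioo (-π) π)
    (h : foldRot θ γ = foldRot θ γ') : γ = γ' := by
  have h3 := sin_sq_add_cos_sq θ
  have hs : sin γ = sin γ' := by
    have h1 := congrFun (congrFun h 2) 0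
    have h2 := congrFun (congrFun h 2) 1
    simp [foldRot_eq_of] at h1 h2
    grind
  have hc : cos γ = cos γ' := by
    have h1 := congrFun (congrFun h 2) 2
    simpa [foldRot_eq_of] using h1
  have := Real.Angle.cos_sin_inj hc hs
  have h4 := congrArg Real.Angle.toReal this
  rwa [Real.Angle.toReal_coe_eq_self_iff.2 ⟨hγ.1, hγ.2.le⟩,
    Real.Angle.toReal_coe_eq_self_iff.2 ⟨hγ'.1, hγ'.2.le⟩] at h4

/-! ### Moving a vertex to the normal position. -/

/-- The isometry of the plane that takes polar angle `φ` to `θ + o * φ`, where `o = ±1`. -/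
noncomputable def frame (θ o : ℝ) : Matrix (Fin 3) (Fin 3) ℝ :=
  !![cos θ, -(o * sin θ), 0; sin θ, o * cos θ, 0; 0, 0, 1]

theorem frame_mul_transpose {o : ℝ} (ho : o * o = 1) (θ : ℝ) :
    frame θ o * (frame θ o)ᵀ = 1 := by
  have h3 := sin_sq_add_cos_sq θ
  ext i j
  fin_cases i <;> fin_cases j <;> simp [frame, Matrix.mul_apply, Fin.sum_univ_three] <;> grind

/-- For `o = -1` the frame is a reflection, and conjugating a rotation by a reflection reverses its
angle. This lets the clockwise vertices `b`, `c` be treated together with `a`, `d`. -/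
theorem foldRot_eq_conj_frame {o : ℝ} (ho : o = 1 ∨ o = -1) (θ φ γ : ℝ) :
    foldRot (θ + o * φ) (o * γ) = frame θ o * foldRot φ γ * (frame θ o)ᵀ := by
  have h3 := sin_sq_add_cos_sq θ
  have h4 := sin_sq_add_cos_sq φ
  have hc : cos (θ + o * φ) = cos θ * cos φ - o * (sin θ * sin φ) := by
    rcases ho with rfl | rfl <;> simp [cos_add]
  have hs : sin (θ + o * φ) = sin θ * cos φ + o * (cos θ * sin φ) := by
    rcases ho with rfl | rfl <;> simp [sin_add]
  have hc' : cos (o * γ) = cos γ := by rcases ho with rfl | rfl <;> simp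
  have hs' : sin (o * γ) = o * sin γ := by rcases ho with rfl | rfl <;> simp
  have ho' : o ^ 2 = 1 := by rcases ho with rfl | rfl <;> norm_num
  rw [foldRot_eq_of, foldRot_eq_of, hc, hs, hc', hs', frame]
  generalize cos θ = a at *
  generalize sin θ = b at *
  generalize cos φ = c at *
  generalize sin φ = d at *
  clear hc hs hc' hs'
  ext i j
  fin_cases i <;> fin_cases j <;>
    simp [Matrix.mul_apply, Fin.sum_univ_three] <;> grind

/-- Four folds about concurrent horizontal axes close up if and only if they do after an isometry
of the plane. -/
theorem foldRot_closed_iff {o : ℝ} (ho : o = 1 ∨ o = -1) (θ φ₀ φ₁ φ₂ φ₃ γ₀ γ₁ γ₂ γ₃ : ℝ) :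
    foldRot (θ + o * φ₀) (o * γ₀) * foldRot (θ + o * φ₁) (o * γ₁) *
        foldRot (θ + o * φ₂) (o * γ₂) * foldRot (θ + o * φ₃) (o * γ₃) = 1 ↔
      foldRot φ₀ γ₀ * foldRot φ₁ γ₁ * foldRot φ₂ γ₂ * foldRot φ₃ γ₃ = 1 := by
  have h : frame θ o * (frame θ o)ᵀ = 1 :=
    frame_mul_transpose (by rcases ho with rfl | rfl <;> norm_num) θ
  have h' : (frame θ o)ᵀ * frame θ o = 1 := mul_eq_one_comm.1 h
  simp only [foldRot_eq_conj_frame ho]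
  generalize frame θ o = C at *
  generalize Cᵀ = D at *
  generalize foldRot φ₀ γ₀ = A₀
  generalize foldRot φ₁ γ₁ = A₁
  generalize foldRot φ₂ γ₂ = A₂
  generalize foldRot φ₃ γ₃ = A₃
  have e : C * A₀ * D * (C * A₁ * D) * (C * A₂ * D) * (C * A₃ * D) =
      C * (A₀ * A₁ * A₂ * A₃) * D := by
    calc _ = C * A₀ * (D * C) * A₁ * (D * C) * A₂ * (D * C) * A₃ * D := by
          simp only [Matrix.mul_assoc]
      _ = _ := by simp only [h', Matrix.mul_one, Matrix.mul_assoc]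
  rw [e]
  constructor
  · intro h1
    calc A₀ * A₁ * A₂ * A₃ = (D * C) * (A₀ * A₁ * A₂ * A₃) * (D * C) := by simp [h']
      _ = D * (C * (A₀ * A₁ * A₂ * A₃) * D) * C := by simp only [Matrix.mul_assoc]
      _ = 1 := by rw [h1, Matrix.mul_one, h']
  · intro h1
    rw [h1, Matrix.mul_one, h]

/-! ### The closing condition at one vertex. -/

/-- A unit quaternion is determined by its rotation up to sign, hence uniquely by its rotation and
the sign of a linear functional. -/
theorem eq_of_quatMat_eq {w x y z w' x' y' z' a b : ℝ}
    (h : quatMat w x y z = quatMat w' x' y' z') (hn : w ^ 2 + x ^ 2 + y ^ 2 + z ^ 2 = 1)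
    (hn' : w' ^ 2 + x' ^ 2 + y' ^ 2 + z' ^ 2 = 1) (hL : 0 < a * w + b * z)
    (hL' : 0 < a * w' + b * z') : w = w' ∧ x = x' ∧ y = y' ∧ z = z' := by
  have e (i j : Fin 3) := congrFun (congrFun h i) j
  have e00 := e 0 0
  have e01 := e 0 1
  have e02 := e 0 2
  have e10 := e 1 0
  have e11 := e 1 1
  have e12 := e 1 2
  have e20 := e 2 0
  have e21 := e 2 1
  have e22 := e 2 2
  simp only [quatMat, of_apply, cons_val', cons_val_zero, cons_val_fin_one, cons_val_one,
    cons_val] at e00 e01 e02 e10 e11 e12 e20 e21 e22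
  have hww : w * w = w' * w' := by linarith
  have hzz : z * z = z' * z' := by linarith
  have hwx : w * x = w' * x' := by linarith
  have hwy : w * y = w' * y' := by linarith
  have hwz : w * z = w' * z' := by linarith
  have hxz : x * z = x' * z' := by linarith
  have hyz : y * z = y' * z' := by linarith
  have hLL : a * w + b * z = a * w' + b * z' := by
    rw [← sq_eq_sq₀ hL.le hL'.le]
    linear_combination a ^ 2 * hww + 2 * a * b * hwz + b ^ 2 * hzz
  refine ⟨?_, ?_, ?_, ?_⟩ <;> apply mul_left_cancel₀ hL.ne'
  · linear_combination a * hww + b * hwz - w' * hLL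
  · linear_combination a * hwx + b * hxz - x' * hLL
  · linear_combination a * hwy + b * hyz - y' * hLL
  · linear_combination a * hwz + b * hzz - z' * hLL

/-- The quaternion of a product of two folds. -/
theorem foldRot_mul_foldRot (φ₀ φ₁ γ₀ γ₁ : ℝ) :
    foldRot φ₀ γ₀ * foldRot φ₁ γ₁ =
      quatMat (cos (γ₀ / 2) * cos (γ₁ / 2) - sin (γ₀ / 2) * sin (γ₁ / 2) * cos (φ₁ - φ₀))
        (cos (γ₀ / 2) * sin (γ₁ / 2) * cos φ₁ + cos (γ₁ / 2) * sin (γ₀ / 2) * cos φ₀)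
        (cos (γ₀ / 2) * sin (γ₁ / 2) * sin φ₁ + cos (γ₁ / 2) * sin (γ₀ / 2) * sin φ₀)
        (sin (γ₀ / 2) * sin (γ₁ / 2) * sin (φ₁ - φ₀)) := by
  rw [foldRot_eq_quatMat, foldRot_eq_quatMat, quatMat_mul, cos_sub, sin_sub]
  congr 1 <;> ring

theorem foldRot_mul_foldRot_norm (φ₀ φ₁ γ₀ γ₁ : ℝ) :
    (cos (γ₀ / 2) * cos (γ₁ / 2) - sin (γ₀ / 2) * sin (γ₁ / 2) * cos (φ₁ - φ₀)) ^ 2 +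
        (cos (γ₀ / 2) * sin (γ₁ / 2) * cos φ₁ + cos (γ₁ / 2) * sin (γ₀ / 2) * cos φ₀) ^ 2 +
        (cos (γ₀ / 2) * sin (γ₁ / 2) * sin φ₁ + cos (γ₁ / 2) * sin (γ₀ / 2) * sin φ₀) ^ 2 +
        (sin (γ₀ / 2) * sin (γ₁ / 2) * sin (φ₁ - φ₀)) ^ 2 = 1 := by
  have h0 := sin_sq_add_cos_sq (γ₀ / 2)
  have h1 := sin_sq_add_cos_sq (γ₁ / 2)
  have h2 := sin_sq_add_cos_sq φ₀
  have h3 := sin_sq_add_cos_sq φ₁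
  have h4 := sin_sq_add_cos_sq (φ₁ - φ₀)
  have h5 := cos_sub φ₁ φ₀
  grind

/-- Four folds about horizontal axes that close up, where the angle between the last two axes is
supplementary to the one between the first two. -/
theorem half_angles_of_closed {φ₀ φ₁ φ₂ φ₃ γ₀ γ₁ γ₂ γ₃ : ℝ}
    (h : foldRot φ₀ γ₀ * foldRot φ₁ γ₁ * foldRot φ₂ γ₂ * foldRot φ₃ γ₃ = 1)
    (h₀ : 0 < cos (γ₀ / 2)) (h₁ : 0 < cos (γ₁ / 2)) (h₂ : 0 < cos (γ₂ / 2))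
    (h₃ : 0 < cos (γ₃ / 2)) (hs : 0 < sin (φ₁ - φ₀)) (hs' : sin (φ₃ - φ₂) = sin (φ₁ - φ₀))
    (hc' : cos (φ₃ - φ₂) = -cos (φ₁ - φ₀)) :
    cos (γ₀ / 2) * cos (γ₁ / 2) = cos (γ₂ / 2) * cos (γ₃ / 2) ∧
    cos (γ₀ / 2) * sin (γ₁ / 2) * cos φ₁ + cos (γ₁ / 2) * sin (γ₀ / 2) * cos φ₀ =
      -(cos (γ₂ / 2) * sin (γ₃ / 2) * cos φ₃ + cos (γ₃ / 2) * sin (γ₂ / 2) * cos φ₂) := by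
  have e : foldRot φ₀ γ₀ * foldRot φ₁ γ₁ = (foldRot φ₂ γ₂ * foldRot φ₃ γ₃)ᵀ := by
    have e1 : (foldRot φ₂ γ₂ * foldRot φ₃ γ₃) * (foldRot φ₂ γ₂ * foldRot φ₃ γ₃)ᵀ = 1 := by
      rw [foldRot_mul_foldRot]
      exact quatMat_mul_transpose (foldRot_mul_foldRot_norm _ _ _ _)
    rw [Matrix.mul_assoc] at h
    exact left_inv_eq_right_inv h e1
  rw [foldRot_mul_foldRot, foldRot_mul_foldRot, quatMat_transpose, hs', hc'] at e
  have n := foldRot_mul_foldRot_norm φ₂ φ₃ γ₂ γ₃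
  rw [hs', hc'] at n
  have p01 := mul_pos (mul_pos h₀ h₁) hs
  have p23 := mul_pos (mul_pos h₂ h₃) hs
  -- This functional cancels the terms with two half-angle sines: on the two sides it equals `sin
  -- (φ₁ - φ₀)` times the product of the two half-angle cosines, which is positive and so settles
  -- the sign of the quaternion.
  obtain ⟨ew, ex, -, ez⟩ := eq_of_quatMat_eq (a := sin (φ₁ - φ₀)) (b := cos (φ₁ - φ₀)) e
    (foldRot_mul_foldRot_norm _ _ _ _) (by linarith) (by linarith) (by linarith)
  refine ⟨?_, ex⟩
  apply mul_left_cancel₀ hs.ne'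
  linear_combination sin (φ₁ - φ₀) * ew + cos (φ₁ - φ₀) * ez

/-- Folding angles of a closed flat-foldable vertex, in the normal position. -/
theorem cos_half_angles_of_closed {α β γ₀ γ₁ γ₂ γ₃ : ℝ} (hα : α ∈ Ioo 0 π) (hβ : β ∈ Ioo 0 π)
    (h : foldRot 0 γ₀ * foldRot α γ₁ * foldRot (α + β) γ₂ * foldRot (π + β) γ₃ = 1)
    (h₀ : 0 < cos (γ₀ / 2)) (h₁ : 0 < cos (γ₁ / 2)) (h₂ : 0 < cos (γ₂ / 2))
    (h₃ : 0 < cos (γ₃ / 2)) :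
    cos (γ₂ / 2) = cos (γ₀ / 2) ∧ cos (γ₃ / 2) = cos (γ₁ / 2) ∧
    cos (γ₀ / 2) * sin (γ₁ / 2) * cos α + cos (γ₁ / 2) * sin (γ₀ / 2) =
      cos (γ₂ / 2) * sin (γ₃ / 2) * cos β - cos (γ₃ / 2) * sin (γ₂ / 2) * cos (α + β) := by
  obtain ⟨e1, e2⟩ := half_angles_of_closed h h₀ h₁ h₂ h₃
    (by simpa using sin_pos_of_mem_Ioo hα)
    (by rw [show π + β - (α + β) = π - α by ring, sin_pi_sub, sub_zero])
    (by rw [show π + β - (α + β) = π - α by ring, cos_pi_sub, sub_zero])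
  -- The cyclically shifted product satisfies the same hypotheses with `β` in place of `α`. The two
  -- cosine identities together separate the opposite pairs.
  have h' : foldRot α γ₁ * foldRot (α + β) γ₂ * foldRot (π + β) γ₃ * foldRot 0 γ₀ = 1 := by
    rw [← mul_eq_one_comm]
    simpa only [Matrix.mul_assoc] using h
  obtain ⟨e3, -⟩ := half_angles_of_closed h' h₁ h₂ h₃ h₀
    (by simpa using sin_pos_of_mem_Ioo hβ)
    (by rw [show 0 - (π + β) = -(β + π) by ring, sin_neg, sin_add_pi, add_sub_cancel_left, neg_neg])
    (by rw [show 0 - (π + β) = -(β + π) by ring, cos_neg, cos_add_pi, add_sub_cancel_left])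
  have e4 : cos (γ₁ / 2) = cos (γ₃ / 2) := by
    rw [← sq_eq_sq₀ h₁.le h₃.le]
    apply mul_left_cancel₀ (mul_pos h₀ h₂).ne'
    linear_combination cos (γ₁ / 2) * cos (γ₂ / 2) * e1 + cos (γ₂ / 2) * cos (γ₃ / 2) * e3
  refine ⟨?_, e4.symm, ?_⟩
  · rw [e4] at e1
    exact (mul_right_cancel₀ h₃.ne' e1).symm
  · rw [cos_zero, add_comm π β, cos_add_pi] at e2
    linear_combination e2

theorem cos_half_pos {γ : ℝ} (h : γ ∈ Ioo (-π) π) : 0 < cos (γ / 2) :=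
  cos_pos_of_mem_Ioo ⟨by linarith [h.1], by linarith [h.2]⟩

theorem eq_sign_mul_of_cos_half_eq {γ γ' : ℝ} {τ : SignType} (h : γ ∈ Ioo (-π) π)
    (h' : γ' ∈ Ioo (-π) π) (hc : cos (γ' / 2) = cos (γ / 2))
    (hs : SignType.sign γ' = τ * SignType.sign γ) : γ' = τ * γ := by
  have habs : |γ'| = |γ| := by
    have := abs_lt.2 h
    have := abs_lt.2 h'
    have e : |γ'| / 2 = |γ| / 2 := by
      apply injOn_cos ⟨by positivity, by linarith [pi_pos]⟩ ⟨by positivity, by linarith [pi_pos]⟩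
      have (x : ℝ) : cos (|x| / 2) = cos (x / 2) := by
        rw [← abs_two, ← abs_div, cos_abs, abs_two]
      rw [this, this, hc]
    linarith
  rw [← sign_mul_abs γ', hs, habs, SignType.coe_mul, mul_assoc, sign_mul_abs]

/-! ### The fold angle multiplier. -/

/-- The multiplier of a vertex is a well-defined nonzero number. -/
theorem mu₂_data {α β : ℝ} {σ : SignType} (hα : α ∈ Ioo 0 π) (hβ : β ∈ Ioo 0 π)
    (hσ : σ ∈ MV α β) :
    (σ = 1 ∨ σ = -1) ∧ cos β - σ * cos α ≠ 0 ∧ 0 < 1 - σ * cos (α + β) ∧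
      0 < 1 - σ * cos (α - β) ∧ mu₂ σ α β * (cos β - σ * cos α) = -(σ - cos (α - β)) := by
  have hlt : -1 < cos (α + β) ∨ α + β = π := by
    by_contra! h
    have h1 : cos (α + β) = -1 := le_antisymm h.1 (neg_one_le_cos _)
    have h2 : cos (α + β - π) = 1 := by rw [cos_sub_pi, h1, neg_neg]
    rw [cos_eq_one_iff_of_lt_of_lt (by linarith [hα.1, hβ.1, pi_pos])
      (by linarith [hα.2, hβ.2, pi_pos])] at h2
    exact h.2 (by linarith)
  have hlt' : cos (α + β) < 1 := by
    refine lt_of_le_of_ne (cos_le_one _) fun h => ?_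
    have h2 : cos (α + β) = cos (2 * π - (α + β)) := by rw [cos_two_pi_sub]
    by_cases h3 : α + β < 2 * π
    · have := (cos_eq_one_iff_of_lt_of_lt (by linarith [hα.1, hβ.1]) h3).1 h
      linarith [hα.1, hβ.1]
    · linarith [hα.2, hβ.2]
  have hm : -1 < cos (α - β) := by
    rw [← cos_pi, ← cos_abs (α - β)]
    exact cos_lt_cos_of_nonneg_of_le_pi (abs_nonneg _) le_rfl
      (abs_lt.2 ⟨by linarith [hα.1, hβ.2], by linarith [hα.2, hβ.1]⟩)
  have hm' : cos (α - β) < 1 ∨ α = β := by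
    by_contra! h
    have := (cos_eq_one_iff_of_lt_of_lt (by linarith [hα.1, hβ.2, pi_pos])
      (by linarith [hα.2, hβ.1, pi_pos])).1 (le_antisymm (cos_le_one _) h.1)
    exact h.2 (by linarith)
  have hinj : cos β = cos α → α = β := fun h =>
    (injOn_cos ⟨hβ.1.le, hβ.2.le⟩ ⟨hα.1.le, hα.2.le⟩ h).symm
  have hinj' : cos β = -cos α → α = π - β := fun h => by
    have := injOn_cos ⟨hβ.1.le, hβ.2.le⟩ (⟨by linarith [hα.2], by linarith [hα.1]⟩ :
      π - α ∈ Icc 0 π) (by rw [h, cos_pi_sub])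
    linarith
  -- `MV` excludes exactly the cases in which the denominator of the multiplier vanishes.
  have key : (σ = 1 ∧ α ≠ β) ∨ (σ = -1 ∧ α ≠ π - β) := by
    unfold MV at hσ
    split_ifs at hσ with h1 h2 h3
    · exact absurd hσ (by simp)
    · refine Or.inr ⟨hσ, fun h4 => h1 ⟨by linarith, by linarith⟩⟩
    · exact Or.inl ⟨hσ, h2⟩
    · rcases hσ with hσ | hσ
      · exact Or.inl ⟨hσ, h2⟩
      · exact Or.inr ⟨hσ, h3⟩
  have hne : cos β - σ * cos α ≠ 0 := by
    rcases key with ⟨rfl, h⟩ | ⟨rfl, h⟩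
    · intro h5
      exact h (hinj (by simpa [sub_eq_zero] using h5))
    · intro h5
      exact h (hinj' (by simp at h5; linarith))
  refine ⟨key.imp And.left And.left, hne, ?_, ?_, ?_⟩
  · rcases key with ⟨rfl, h⟩ | ⟨rfl, h⟩
    · simpa using hlt'
    · have := hlt.resolve_right fun h5 => h (by linarith)
      simp
      linarith
  · rcases key with ⟨rfl, h⟩ | ⟨rfl, h⟩
    · simpa using hm'.resolve_right h
    · simp
      linarith
  · rw [mu₂, div_mul_cancel₀ _ hne, cos_sub]
    ring

theorem mu₂_ne_zero {α β : ℝ} {σ : SignType} (hα : α ∈ Ioo 0 π) (hβ : β ∈ Ioo 0 π)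
    (hσ : σ ∈ MV α β) : mu₂ σ α β ≠ 0 := by
  obtain ⟨h1, h2, h3, h4, h5⟩ := mu₂_data hα hβ hσ
  intro h
  rw [h, zero_mul] at h5
  rcases h1 with rfl | rfl <;> simp at h4 h5 <;> linarith

/-- This factorization turns the defining quotient of `mu₂` into the equivalent quotient with
denominator `1 - σ cos (α + β)`, which is the one that the closing condition produces. -/
theorem sq_cos_sub_sign_mul_cos {α β : ℝ} {σ : SignType} (hσ : σ = 1 ∨ σ = -1) :
    (cos β - σ * cos α) ^ 2 = (1 - σ * cos (α + β)) * (1 - σ * cos (α - β)) := by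
  have h1 := sin_sq_add_cos_sq α
  have h2 := sin_sq_add_cos_sq β
  rw [cos_add, cos_sub]
  rcases hσ with rfl | rfl <;> simp <;> grind

/-- The tangent relation is cleared of denominators so that it also covers the folded flat state
with angles `±π`. The first two folds have to give the conjugate quaternion of the last two. The `w`
and `z` components then agree because `σ² = 1`, and `e1`, `e2` are the `x` and `y` components. -/
theorem closed_of_half_angles {α β γ₀ γ₁ : ℝ} {σ : SignType} (hα : α ∈ Ioo 0 π)
    (hβ : β ∈ Ioo 0 π) (hσ : σ ∈ MV α β)
    (h : sin (γ₀ / 2) * cos (γ₁ / 2) = -mu₂ σ α β * (sin (γ₁ / 2) * cos (γ₀ / 2))) :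
    foldRot 0 γ₀ * foldRot α γ₁ * foldRot (α + β) (-σ * γ₀) * foldRot (π + β) (σ * γ₁) = 1 := by
  obtain ⟨h1, h2, h3, h4, h5⟩ := mu₂_data hα hβ hσ
  have h6 := sq_cos_sub_sign_mul_cos (α := α) (β := β) h1
  have e1 : (sin (γ₀ / 2) * cos (γ₁ / 2)) * (1 - σ * cos (α + β)) +
      (sin (γ₁ / 2) * cos (γ₀ / 2)) * (cos α - σ * cos β) = 0 := by
    apply mul_left_cancel₀ h2
    rcases h1 with rfl | rfl <;> simp at * <;> grind
  have e2 : (sin (γ₀ / 2) * cos (γ₁ / 2)) * (-σ * sin (α + β)) +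
      (sin (γ₁ / 2) * cos (γ₀ / 2)) * (sin α - σ * sin β) = 0 := by
    apply mul_left_cancel₀ h2
    rw [cos_sub] at h5
    rw [sin_add]
    clear h6 e1 h3 h4 hσ
    have hcα := sin_sq_add_cos_sq α
    have hcβ := sin_sq_add_cos_sq β
    rcases h1 with rfl | rfl <;> simp only [SignType.coe_one, SignType.coe_neg] at * <;> grind
  have hσc (x : ℝ) : cos (σ * x / 2) = cos (x / 2) := by
    rcases h1 with rfl | rfl <;> simp [neg_div]
  have hσs (x : ℝ) : sin (σ * x / 2) = σ * sin (x / 2) := by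
    rcases h1 with rfl | rfl <;> simp [neg_div]
  have hσσ : (σ : ℝ) * σ = 1 := by rcases h1 with rfl | rfl <;> simp
  have n := foldRot_mul_foldRot_norm 0 α γ₀ γ₁
  rw [Matrix.mul_assoc, foldRot_mul_foldRot, foldRot_mul_foldRot,
    ← quatMat_mul_transpose n, quatMat_transpose, neg_mul, neg_div, cos_neg, sin_neg, hσc, hσc,
    hσs, hσs, show π + β - (α + β) = π - α by ring, cos_pi_sub, sin_pi_sub, add_comm π β,
    cos_add_pi, sin_add_pi, cos_zero, sin_zero, sub_zero]
  congr 2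
  · linear_combination -(cos α * sin (γ₀ / 2) * sin (γ₁ / 2)) * hσσ
  · linear_combination e1
  · linear_combination e2
  · linear_combination -(sin α * sin (γ₀ / 2) * sin (γ₁ / 2)) * hσσ

theorem half_angles_of_assignment {α β γ₀ γ₁ γ₂ γ₃ : ℝ} {σ : SignType} (hα : α ∈ Ioo 0 π)
    (hβ : β ∈ Ioo 0 π) (hσ : σ ∈ MV α β)
    (h : foldRot 0 γ₀ * foldRot α γ₁ * foldRot (α + β) γ₂ * foldRot (π + β) γ₃ = 1)
    (h₀ : γ₀ ∈ Ioo (-π) π) (h₁ : γ₁ ∈ Ioo (-π) π) (h₂ : γ₂ ∈ Ioo (-π) π) (h₃ : γ₃ ∈ Ioo (-π) π)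
    (hs₂ : SignType.sign γ₂ = -σ * SignType.sign γ₀)
    (hs₃ : SignType.sign γ₃ = σ * SignType.sign γ₁) :
    γ₂ = -σ * γ₀ ∧ γ₃ = σ * γ₁ ∧ tan (γ₀ / 2) = -mu₂ σ α β * tan (γ₁ / 2) := by
  obtain ⟨e2, e3, e⟩ := cos_half_angles_of_closed hα hβ h (cos_half_pos h₀) (cos_half_pos h₁)
    (cos_half_pos h₂) (cos_half_pos h₃)
  have g2 := eq_sign_mul_of_cos_half_eq h₀ h₂ e2 hs₂
  have g3 := eq_sign_mul_of_cos_half_eq h₁ h₃ e3 hs₃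
  rw [SignType.coe_neg] at g2
  refine ⟨g2, g3, ?_⟩
  obtain ⟨h1, d2, d3, d4, d5⟩ := mu₂_data hα hβ hσ
  have d6 := sq_cos_sub_sign_mul_cos (α := α) (β := β) h1
  have hσs (x : ℝ) : sin (σ * x / 2) = σ * sin (x / 2) := by
    rcases h1 with rfl | rfl <;> simp [neg_div]
  rw [e2, e3, g2, g3, neg_mul, neg_div, sin_neg, hσs, hσs] at e
  -- After substituting the opposite angles, `e` is homogeneous and linear in these two products;
  -- the ratio of its coefficients is the multiplier.
  have hlin : sin (γ₀ / 2) * cos (γ₁ / 2) = -mu₂ σ α β * (sin (γ₁ / 2) * cos (γ₀ / 2)) := by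
    apply mul_left_cancel₀ (mul_ne_zero d2 d3.ne')
    rcases h1 with rfl | rfl <;> simp at * <;> grind
  have c0 := (cos_half_pos h₀).ne'
  have c1 := (cos_half_pos h₁).ne'
  rw [tan_eq_sin_div_cos, tan_eq_sin_div_cos]
  field_simp
  linear_combination hlin

theorem one_mem_MV {α β : ℝ} (h : α ≠ β) : (1 : SignType) ∈ MV α β := by
  unfold MV
  split_ifs with h1
  · exact absurd (h1.1.trans h1.2.symm) h
  · rfl
  · exact Or.inl rfl

theorem neg_one_mem_MV {α β : ℝ} (h : α ≠ π - β) : (-1 : SignType) ∈ MV α β := by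
  unfold MV
  split_ifs with h1
  · exact absurd (by rw [h1.1, h1.2]; ring) h
  · rfl
  · exact Or.inr rfl

/-! ### The multiplier as a function of the second sector angle. -/

/-- The two multipliers of a vertex are inverse to each other. -/
theorem mu₁_neg_eq_inv {α β : ℝ} {σ : SignType} (hα : α ∈ Ioo 0 π) (hβ : β ∈ Ioo 0 π)
    (hσ : σ ∈ MV α β) : mu₁ (-σ) α β = (mu₂ σ α β)⁻¹ := by
  obtain ⟨h1, h2, -, -, h5⟩ := mu₂_data hα hβ hσ
  have h6 := sq_cos_sub_sign_mul_cos (α := α) (β := β) h1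
  have hσσ : (σ : ℝ) * σ = 1 := by rcases h1 with rfl | rfl <;> simp
  apply eq_inv_of_mul_eq_one_left
  have h7 : mu₁ (-σ) α β * (cos β - σ * cos α) = -(σ - cos (α + β)) := by
    rw [mu₁, mu₂, cos_pi_sub, sin_pi_sub, cos_add, SignType.coe_neg,
      show -cos β - -(σ : ℝ) * cos α = -(cos β - σ * cos α) by ring, div_neg, neg_mul,
      div_mul_cancel₀ _ h2]
    ring
  apply mul_left_cancel₀ (pow_ne_zero 2 h2)
  rw [mul_one]
  calc (cos β - σ * cos α) ^ 2 * (mu₁ (-σ) α β * mu₂ σ α β)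
      = (mu₁ (-σ) α β * (cos β - σ * cos α)) * (mu₂ σ α β * (cos β - σ * cos α)) := by ring
    _ = (σ - cos (α + β)) * (σ - cos (α - β)) := by rw [h5, h7]; ring
    _ = _ := by
      rw [h6]
      linear_combination (1 - cos (α + β) * cos (α - β)) * hσσ

/-- The multiplier determines the assignment and the second sector angle. -/
theorem eq_of_mu₂ {α β : ℝ} {σ : SignType} (hα : α ∈ Ioo 0 π) (hβ : β ∈ Ioo 0 π)
    (hσ : σ ∈ MV α β) :
    |mu₂ σ α β| ≠ 1 ∧ σ = -SignType.sign (mu₂ σ α β ^ 2 - 1) ∧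
      β = arccos (σ * ((2 * mu₂ σ α β - (mu₂ σ α β ^ 2 + 1) * cos α) /
        (2 * mu₂ σ α β * cos α - (mu₂ σ α β ^ 2 + 1)))) := by
  obtain ⟨h1, h2, h3, -, h5⟩ := mu₂_data hα hβ hσ
  have h6 := sq_cos_sub_sign_mul_cos (α := α) (β := β) h1
  generalize mu₂ σ α β = m at *
  have hσσ : (σ : ℝ) * σ = 1 := by rcases h1 with rfl | rfl <;> simp
  have hsα := sin_pos_of_mem_Ioo hα
  have hsβ := sin_pos_of_mem_Ioo hβ
  have hcα := sin_sq_add_cos_sq α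
  have e1 : m * (1 - σ * cos (α + β)) = -σ * (cos β - σ * cos α) := by
    apply mul_left_cancel₀ h2
    linear_combination (1 - σ * cos (α + β)) * h5 + σ * h6 -
      (cos (α - β) * (1 - σ * cos (α + β))) * hσσ
  have e2 : m ^ 2 * (1 - σ * cos (α + β)) = 1 - σ * cos (α - β) := by
    linear_combination m * e1 - σ * h5 + hσσ
  -- Both `1 - σ cos (α + β)` and the product of sines are positive, so `m² - 1` is nonzero with the
  -- sign of `-σ`.
  have e3 : (m ^ 2 - 1) * (1 - σ * cos (α + β)) = -σ * (2 * sin α * sin β) := by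
    rw [sub_mul, e2, cos_add, cos_sub]
    ring
  have e4 : (m ^ 2 + 1) * (1 - σ * cos (α + β)) = 2 - 2 * σ * (cos α * cos β) := by
    rw [add_mul, e2, cos_add, cos_sub]
    ring
  have e5 : σ = -SignType.sign (m ^ 2 - 1) := by
    have hp : 0 < 2 * sin α * sin β := by positivity
    have h8 : SignType.sign (m ^ 2 - 1) = SignType.sign ((m ^ 2 - 1) * (1 - σ * cos (α + β))) := by
      rw [sign_mul, sign_pos h3, mul_one]
    rw [h8, e3, sign_mul, sign_pos hp, mul_one]
    rcases h1 with rfl | rfl <;> simp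
  refine ⟨fun h => ?_, e5, ?_⟩
  · have : m ^ 2 - 1 = 0 := by rw [← sq_abs, h]; norm_num
    rw [this, _root_.sign_zero, neg_zero] at e5
    rcases h1 with rfl | rfl <;> cases e5
  -- Up to this common factor, denominator and numerator of the claimed fraction are `-2 sin² α` and
  -- `-2 σ cos β sin² α`, so the fraction is `σ cos β`.
  · have e6 : (2 * m * cos α - (m ^ 2 + 1)) * (1 - σ * cos (α + β)) = -2 * sin α ^ 2 := by
      linear_combination 2 * cos α * e1 - e4 + 2 * cos α ^ 2 * hσσ + 2 * hcα
    have e7 : (2 * m - (m ^ 2 + 1) * cos α) * (1 - σ * cos (α + β)) =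
        -2 * σ * cos β * sin α ^ 2 := by
      linear_combination 2 * e1 - cos α * e4 + 2 * cos α * hσσ + 2 * σ * cos β * hcα
    rw [← mul_div_mul_right _ _ h3.ne', e6, e7,
      show -2 * (σ : ℝ) * cos β * sin α ^ 2 = (σ * cos β) * (-2 * sin α ^ 2) by ring,
      mul_div_cancel_right₀ _ (by simp [hsα.ne']), ← mul_assoc, hσσ, one_mul,
      arccos_cos hβ.1.le hβ.2.le]

/-- Every number other than `0`, `1`, `-1` is the multiplier of a vertex with given first sector
angle. -/
theorem exists_mu₂_eq {α μ : ℝ} (hα : α ∈ Ioo 0 π) (h0 : μ ≠ 0) (h1 : |μ| ≠ 1) :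
    ∃ β ∈ Ioo 0 π, ∃ σ ∈ MV α β, mu₂ σ α β = μ := by
  have hA : 0 < cos (α / 2) :=
    cos_pos_of_mem_Ioo ⟨by linarith [hα.1, pi_pos], by linarith [hα.2]⟩
  have hA' : 0 < sin (α / 2) := 
    sin_pos_of_pos_of_lt_pi (by linarith [hα.1]) (by linarith [hα.2, pi_pos])
  have hβ {t : ℝ} (ht : 0 < t) : 2 * arctan t ∈ Ioo 0 π :=
    ⟨by linarith [arctan_pos.2 ht], by linarith [arctan_lt_pi_div_two t]⟩
  have hB (t : ℝ) : sin (arctan t) = t * cos (arctan t) := by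
    have := tan_mul_cos (cos_arctan_pos t).ne'
    rw [tan_arctan] at this
    exact this.symm
  have hα2 : α = 2 * (α / 2) := by ring
  rcases lt_or_gt_of_ne h1 with h | h
  · obtain ⟨h2, h3⟩ := abs_lt.1 h
    -- For `σ = 1` the multiplier is `-sin ((α - β)/2) / sin ((α + β)/2)`. Setting this equal to `μ`
    -- and solving for `tan (β/2)` gives `t`, which is positive because `|μ| < 1`.
    set t := sin (α / 2) * (1 + μ) / (cos (α / 2) * (1 - μ)) with ht
    have ht0 : 0 < t := by
      have : 0 < 1 + μ := by linarith
      have : 0 < 1 - μ := by linarith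
      positivity
    have ht1 : cos (α / 2) * t * (1 - μ) = sin (α / 2) * (1 + μ) := by
      have : 1 - μ ≠ 0 := by linarith
      rw [ht]
      field_simp
    have key : -sin (α / 2 - arctan t) = μ * sin (α / 2 + arctan t) := by
      rw [sin_sub, sin_add, hB]
      linear_combination cos (arctan t) * ht1
    have hm : (1 : SignType) ∈ MV α (2 * arctan t) := by
      apply one_mem_MV
      intro h4
      rw [show arctan t = α / 2 by linarith, sub_self, sin_zero, neg_zero, ← two_mul, ← hα2,
        eq_comm, mul_eq_zero] at key
      exact key.elim h0 (sin_pos_of_mem_Ioo hα).ne'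
    refine ⟨_, hβ ht0, 1, hm, ?_⟩
    obtain ⟨-, d2, -, -, d5⟩ := mu₂_data hα (hβ ht0) hm
    apply mul_right_cancel₀ d2
    rw [d5]
    have e1 : cos (α - 2 * arctan t) = 1 - 2 * sin (α / 2 - arctan t) ^ 2 := by
      rw [show α - 2 * arctan t = 2 * (α / 2 - arctan t) by ring, cos_two_mul']
      linarith [sin_sq_add_cos_sq (α / 2 - arctan t)]
    have e2 : cos (2 * arctan t) - cos α =
        2 * (sin (α / 2 + arctan t) * sin (α / 2 - arctan t)) := by
      rw [cos_sub_cos, show (2 * arctan t + α) / 2 = α / 2 + arctan t by ring,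
        show (2 * arctan t - α) / 2 = -(α / 2 - arctan t) by ring, sin_neg]
      ring
    rw [SignType.coe_one, one_mul, e1, e2]
    linear_combination 2 * sin (α / 2 - arctan t) * key
  -- For `σ = -1` the multiplier is `cos ((α - β)/2) / cos ((α + β)/2)`; again `t` is the solution
  -- for `tan (β/2)`, positive because `|μ| > 1`.
  · set t := cos (α / 2) * (μ - 1) / (sin (α / 2) * (μ + 1)) with ht
    have hp : 0 < (μ - 1) * (μ + 1) := by nlinarith [sq_abs μ]
    have hne : μ + 1 ≠ 0 := right_ne_zero_of_mul hp.ne'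
    have ht0 : 0 < t := by
      have : 0 < (μ - 1) / (μ + 1) := by
        rw [← mul_div_mul_right _ _ hne]
        exact div_pos hp (mul_self_pos.2 hne)
      rw [ht, mul_div_mul_comm]
      positivity
    have ht1 : sin (α / 2) * t * (μ + 1) = cos (α / 2) * (μ - 1) := by
      rw [ht]
      field_simp
    have key : cos (α / 2 - arctan t) = μ * cos (α / 2 + arctan t) := by
      rw [cos_sub, cos_add, hB]
      linear_combination cos (arctan t) * ht1
    have hm : (-1 : SignType) ∈ MV α (2 * arctan t) := by
      apply neg_one_mem_MV
      intro h4
      rw [show α / 2 + arctan t = π / 2 by linarith, cos_pi_div_two, mul_zero] at key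
      exact (cos_pos_of_mem_Ioo ⟨by linarith [hα.1, (hβ ht0).2],
        by linarith [hα.2, (hβ ht0).1]⟩).ne' key
    refine ⟨_, hβ ht0, -1, hm, ?_⟩
    obtain ⟨-, d2, -, -, d5⟩ := mu₂_data hα (hβ ht0) hm
    apply mul_right_cancel₀ d2
    rw [d5]
    have e1 : cos (α - 2 * arctan t) = 2 * cos (α / 2 - arctan t) ^ 2 - 1 := by
      rw [show α - 2 * arctan t = 2 * (α / 2 - arctan t) by ring, cos_two_mul]
    have e2 : cos (2 * arctan t) + cos α =
        2 * (cos (α / 2 + arctan t) * cos (α / 2 - arctan t)) := by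
      rw [cos_add_cos, show (2 * arctan t + α) / 2 = α / 2 + arctan t by ring,
        show (2 * arctan t - α) / 2 = -(α / 2 - arctan t) by ring, cos_neg]
      ring
    rw [SignType.coe_neg, SignType.coe_one, neg_one_mul, sub_neg_eq_add, e1, e2]
    linear_combination 2 * cos (α / 2 - arctan t) * key

/-! ### Existence of crease patterns. -/

/-- The point at signed distance `k` from the point of contact on the tangent of the unit circle
with direction `θ`. -/
noncomputable def tangentPoint (θ k : ℝ) : Fin 3 → ℝ :=
  ![sin θ + k * cos θ, -cos θ + k * sin θ, 0]

theorem tangentPoint_add (θ k l : ℝ) :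
    tangentPoint θ (k + l) = tangentPoint θ k + l • dir θ := by
  ext i
  fin_cases i <;> simp [tangentPoint, dir] <;> ring

theorem dir_add_pi (θ : ℝ) : dir (θ + π) = -dir θ := by
  ext i
  fin_cases i <;> simp [dir]

theorem tangentPoint_sub (θ k l : ℝ) :
    tangentPoint θ (k - l) = tangentPoint θ k + l • dir (θ + π) := by
  rw [sub_eq_add_neg, tangentPoint_add, dir_add_pi, smul_neg, neg_smul]

theorem one_sub_cos_pos {α : ℝ} (h : α ∈ Ioo 0 π) : 0 < 1 - cos α := by
  rw [← cos_zero, sub_pos]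
  exact cos_lt_cos_of_nonneg_of_le_pi le_rfl h.2.le h.1

/-- Two tangents meeting at the interior angle `α`. -/
theorem tangentPoint_turn {α : ℝ} (h : α ∈ Ioo 0 π) (θ : ℝ) :
    tangentPoint θ (sin α / (1 - cos α)) =
      tangentPoint (θ + π - α) (-(sin α / (1 - cos α))) := by
  have h1 := (one_sub_cos_pos h).ne'
  have h2 := sin_sq_add_cos_sq α
  have hk : sin α / (1 - cos α) * (1 - cos α) = sin α := div_mul_cancel₀ _ h1
  have hk' : sin α / (1 - cos α) * sin α = 1 + cos α := by
    rw [div_mul_eq_mul_div, div_eq_iff h1]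
    linear_combination h2
  generalize sin α / (1 - cos α) = k at *
  have hc : cos (θ + π - α) = -(cos θ * cos α + sin θ * sin α) := by
    rw [show θ + π - α = θ - α + π by ring, cos_add_pi, cos_sub]
  have hs : sin (θ + π - α) = -(sin θ * cos α - cos θ * sin α) := by
    rw [show θ + π - α = θ - α + π by ring, sin_add_pi, sin_sub]
  ext i
  fin_cases i <;> simp [tangentPoint, hc, hs]
  · linear_combination cos θ * hk - sin θ * hk'
  · linear_combination sin θ * hk + cos θ * hk'

/-- A quadrilateral with prescribed angles: one circumscribed about a circle. -/
theorem nonempty_pattern {α β : Vertex → ℝ} (hα : ∀ v, α v ∈ Ioo 0 π)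
    (hd : α .d = 2 * π - α .a - α .b - α .c) : Nonempty (Pattern α β) := by
  -- This is `cot (α v / 2)`, the distance from the corner `v` to the two points of contact on its
  -- sides; each side has the sum of two such lengths.
  let k (v : Vertex) : ℝ := sin (α v) / (1 - cos (α v))
  have hk (v) : 0 < k v := div_pos (sin_pos_of_mem_Ioo (hα v)) (one_sub_cos_pos (hα v))
  let x : Vertex → Fin 3 → ℝ := Vertex.vals (tangentPoint 0 (-k .a))
    (tangentPoint (α .a + α .b) (k .b)) (tangentPoint 0 (k .c))
    (tangentPoint (α .a + α .b) (-k .d))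
  -- Corners were placed on the tangents carrying `ac` and `bd`. Each is now located on the tangent
  -- carrying `ab` or `cd` as well; for `d` the angle sum is used.
  have xb : x .b = tangentPoint (α .a + π) (-k .b) := by
    refine (tangentPoint_turn (hα .b) _).trans ?_
    congr 1
    ring
  have xc : x .c = tangentPoint (π - α .c) (-k .c) := by
    refine (tangentPoint_turn (hα .c) _).trans ?_
    congr 1
    ring
  have xd : x .d = tangentPoint (π - α .c) (k .d) := by
    refine Eq.symm ((tangentPoint_turn (hα .d) _).trans ?_)
    rw [hd]
    change _ = tangentPoint (α .a + α .b) (-(sin (α .d) / (1 - cos (α .d))))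
    rw [hd]
    congr 1
    ring
  have xa : x .a = tangentPoint (α .a + π) (k .a) := by
    refine Eq.symm ((tangentPoint_turn (hα .a) _).trans ?_)
    rw [show α .a + π + π - α .a = 0 + 2 * π by ring]
    simp [tangentPoint, x, Vertex.vals, k]
  let θ₀ : Vertex → ℝ := Vertex.vals 0 (α .a + α .b + π) π (α .a + α .b)
  refine ⟨{
    x := x
    θ := fun v => ![θ₀ v, θ₀ v + v.orient * α v, θ₀ v + v.orient * α v + v.orient * β v,
      θ₀ v + v.orient * α v + v.orient * β v + v.orient * (π - α v)]
    len := fun v => ![k v + k v.nbr₁, k v + k v.nbr₂, 1, 1]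
    x_planar := ?_
    len_pos := ?_
    sector₁ := fun v => rfl
    sector₂ := fun v => rfl
    sector₃ := fun v => rfl
    side₁ := ?_
    side₂ := ?_ }⟩
  · intro v
    cases v <;> simp [x, Vertex.vals, tangentPoint]
  · intro v i
    have h1 := hk v
    have h2 := hk v.nbr₁
    have h3 := hk v.nbr₂
    fin_cases i <;> simp <;> positivity
  · intro v
    cases v
    · change tangentPoint 0 (k .c) = tangentPoint 0 (-k .a) + (k .a + k .c) • dir 0
      rw [← tangentPoint_add]
      congr 1
      ring
    · change tangentPoint (α .a + α .b) (-k .d) = tangentPoint (α .a + α .b) (k .b) +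
        (k .b + k .d) • dir (α .a + α .b + π)
      rw [← tangentPoint_sub]
      congr 1
      ring
    · change tangentPoint 0 (-k .a) = tangentPoint 0 (k .c) + (k .c + k .a) • dir π
      rw [← zero_add π, ← tangentPoint_sub]
      congr 1
      ring
    · change tangentPoint (α .a + α .b) (k .b) = tangentPoint (α .a + α .b) (-k .d) +
        (k .d + k .b) • dir (α .a + α .b)
      rw [← tangentPoint_add]
      congr 1
      ring
  · intro v
    cases v
    · change x .b = x .a + (k .a + k .b) • dir (0 + 1 * α .a)
      have : dir (0 + 1 * α .a) = dir (α .a + π + π) := by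
        rw [dir_add_pi, dir_add_pi, neg_neg, zero_add, one_mul]
      rw [this, xa, xb, ← tangentPoint_sub]
      congr 1
      ring
    · change x .a = x .b + (k .b + k .a) • dir (α .a + α .b + π + -1 * α .b)
      rw [xa, xb, show α .a + α .b + π + -1 * α .b = α .a + π by ring, ← tangentPoint_add]
      congr 1
      ring
    · change x .d = x .c + (k .c + k .d) • dir (π + -1 * α .c)
      rw [xc, xd, show π + -1 * α .c = π - α .c by ring, ← tangentPoint_add]
      congr 1
      ring
    · change x .c = x .d + (k .d + k .c) • dir (α .a + α .b + 1 * α .d)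
      rw [xc, xd, show α .a + α .b + 1 * α .d = π - α .c + π by rw [hd]; ring, ← tangentPoint_sub]
      congr 1
      ring

/-! ### Sides seen from their two endpoints. -/

theorem dir_eq_neg_of_smul_add_smul {θ θ' l l' : ℝ} (hl : 0 < l) (hl' : 0 < l')
    (h : l • dir θ + l' • dir θ' = 0) : dir θ' = -dir θ := by
  have hc : l * cos θ + l' * cos θ' = 0 := by simpa [dir] using congrFun h 0
  have hs : l * sin θ + l' * sin θ' = 0 := by simpa [dir] using congrFun h 1
  have e : l = l' := by
    rw [← sq_eq_sq₀ hl.le hl'.le]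
    linear_combination (l * cos θ - l' * cos θ') * hc + (l * sin θ - l' * sin θ') * hs -
      l ^ 2 * sin_sq_add_cos_sq θ + l' ^ 2 * sin_sq_add_cos_sq θ'
  subst e
  rw [← smul_add, smul_eq_zero_iff_right hl.ne'] at h
  exact eq_neg_of_add_eq_zero_right h

theorem continuous_foldRot (θ : ℝ) : Continuous (foldRot θ) := by
  unfold foldRot
  fun_prop

theorem Vertex.nbr₁_nbr₁ (v : Vertex) : v.nbr₁.nbr₁ = v := by cases v <;> rfl

theorem Vertex.nbr₂_nbr₂ (v : Vertex) : v.nbr₂.nbr₂ = v := by cases v <;> rfl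

theorem Vertex.across₁_nbr₁ (v : Vertex) : v.nbr₁.across₁ = v.across₁ := by cases v <;> rfl

theorem Vertex.across₂_nbr₂ (v : Vertex) : v.nbr₂.across₂ = v.across₂ := by cases v <;> rfl

theorem Vertex.orient_nbr₁ (v : Vertex) : v.nbr₁.orient = -v.orient := by
  cases v <;> simp [nbr₁, orient]

theorem Vertex.orient_nbr₂ (v : Vertex) : v.nbr₂.orient = -v.orient := by
  cases v <;> simp [nbr₂, orient]

theorem Vertex.orient_eq (v : Vertex) : v.orient = 1 ∨ v.orient = -1 := by
  cases v <;> simp [Vertex.orient]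

namespace Pattern

variable {α β : Vertex → ℝ} (P : Pattern α β)

theorem dir_nbr₁ (v : Vertex) : dir (P.θ v.nbr₁ 0) = -dir (P.θ v 0) := by
  apply dir_eq_neg_of_smul_add_smul (P.len_pos v 0) (P.len_pos v.nbr₁ 0)
  have h := P.side₁ v.nbr₁
  rw [v.nbr₁_nbr₁, P.side₁ v, add_assoc] at h
  exact left_eq_add.1 h

theorem dir_nbr₂ (v : Vertex) : dir (P.θ v.nbr₂ 1) = -dir (P.θ v 1) := by
  apply dir_eq_neg_of_smul_add_smul (P.len_pos v 1) (P.len_pos v.nbr₂ 1)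
  have h := P.side₂ v.nbr₂
  rw [v.nbr₂_nbr₂, P.side₂ v, add_assoc] at h
  exact left_eq_add.1 h

/-- Passing to the other endpoint reverses both the tangent and the orientation, and the two effects
cancel. Hence a side has one folding angle, whichever endpoint it is read from. -/
theorem foldRot_nbr₁ (v : Vertex) (γ : ℝ) :
    foldRot (P.θ v.nbr₁ 0) (v.nbr₁.orient * γ) = foldRot (P.θ v 0) (v.orient * γ) := by
  rw [v.orient_nbr₁, neg_mul, foldRot_eq_of_dir_eq_neg (P.dir_nbr₁ v)]

theorem foldRot_nbr₂ (v : Vertex) (γ : ℝ) :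
    foldRot (P.θ v.nbr₂ 1) (v.nbr₂.orient * γ) = foldRot (P.θ v 1) (v.orient * γ) := by
  rw [v.orient_nbr₂, neg_mul, foldRot_eq_of_dir_eq_neg (P.dir_nbr₂ v)]

/-- The folds around a vertex close up if and only if they do in the normal position. -/
theorem closed_iff (v : Vertex) (γ : Fin 4 → ℝ) :
    foldRot (P.θ v 0) (v.orient * γ 0) * foldRot (P.θ v 1) (v.orient * γ 1) *
        foldRot (P.θ v 2) (v.orient * γ 2) * foldRot (P.θ v 3) (v.orient * γ 3) = 1 ↔
      foldRot 0 (γ 0) * foldRot (α v) (γ 1) * foldRot (α v + β v) (γ 2) *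
        foldRot (π + β v) (γ 3) = 1 := by
  rw [← foldRot_closed_iff v.orient_eq (P.θ v 0) 0, P.sector₃, P.sector₂, P.sector₁, mul_zero,
    add_zero, add_assoc (P.θ v 0) (_ * α v), ← mul_add, add_assoc, ← mul_add,
    show α v + β v + (π - α v) = π + β v by ring]

/-! ### Necessity of the compatibility condition. -/

section Necessity

variable {P} {R : Panel → Matrix (Fin 3) (Fin 3) ℝ} {b : Panel → Fin 3 → ℝ}
  {γ : Vertex → Fin 4 → ℝ} {σ : Vertex → SignType}

theorem IsFoldingAngles.inner_eq (h : P.IsFoldingAngles R γ) (v : Vertex) :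
    R .inner = R v.across₁ * foldRot (P.θ v 0) (v.orient * γ v 0) := (h v 0).2

theorem IsFoldingAngles.across₂_eq (h : P.IsFoldingAngles R γ) (v : Vertex) :
    R v.across₂ = R .inner * foldRot (P.θ v 1) (v.orient * γ v 1) := (h v 1).2

theorem IsFoldingAngles.corner_eq (h : P.IsFoldingAngles R γ) (v : Vertex) :
    R (.corner v) = R v.across₂ * foldRot (P.θ v 2) (v.orient * γ v 2) := (h v 2).2

theorem IsFoldingAngles.across₁_eq (h : P.IsFoldingAngles R γ) (v : Vertex) :
    R v.across₁ = R (.corner v) * foldRot (P.θ v 3) (v.orient * γ v 3) := (h v 3).2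

theorem IsOrigami.transpose_mul (h : P.IsOrigami R b) (p : Panel) : (R p)ᵀ * R p = 1 :=
  (mem_orthogonalGroup_iff' (Fin 3) ℝ).1 (mem_specialOrthogonalGroup_iff.1 (h.1 p)).1

theorem IsFoldingAngles.closed (h : P.IsFoldingAngles R γ) (ho : P.IsOrigami R b) (v : Vertex) :
    foldRot 0 (γ v 0) * foldRot (α v) (γ v 1) * foldRot (α v + β v) (γ v 2) *
        foldRot (π + β v) (γ v 3) = 1 := by
  rw [← P.closed_iff v (γ v)]
  have e := h.across₁_eq v
  rw [h.corner_eq, h.across₂_eq, h.inner_eq v] at e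
  have e' := congrArg ((R v.across₁)ᵀ * ·) e
  simp only [← Matrix.mul_assoc, ho.transpose_mul, Matrix.one_mul] at e'
  exact e'.symm

theorem IsFoldingAngles.mem_Ioo (h : P.IsFoldingAngles R γ) (hn : Nondegenerate γ) (v : Vertex)
    (i : Fin 4) : γ v i ∈ Ioo (-π) π := by
  have hs : sin (γ v i) ≠ 0 := by
    have := hn v
    simp only [mul_ne_zero_iff] at this
    obtain ⟨⟨⟨h0, h1⟩, h2⟩, h3⟩ := this
    fin_cases i <;> assumption
  obtain ⟨h1, h2⟩ := (h v i).1
  refine ⟨lt_of_le_of_ne h1 fun e => hs ?_, lt_of_le_of_ne h2 fun e => hs ?_⟩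
  · rw [← e, sin_neg, sin_pi, neg_zero]
  · rw [e, sin_pi]

theorem orient_mul_mem_Ioo {γ : ℝ} (v : Vertex) (h : γ ∈ Ioo (-π) π) :
    v.orient * γ ∈ Ioo (-π) π := by
  obtain ⟨h1, h2⟩ := h
  rcases v.orient_eq with e | e <;> rw [e] <;> constructor <;> linarith

theorem IsFoldingAngles.nbr₁_eq (h : P.IsFoldingAngles R γ) (ho : P.IsOrigami R b)
    (hn : Nondegenerate γ) (v : Vertex) : γ v.nbr₁ 0 = γ v 0 := by
  have e := h.inner_eq v.nbr₁
  rw [v.across₁_nbr₁, P.foldRot_nbr₁, h.inner_eq v] at e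
  have e' := congrArg ((R v.across₁)ᵀ * ·) e
  simp only [← Matrix.mul_assoc, ho.transpose_mul, Matrix.one_mul] at e'
  have e2 := foldRot_injective (orient_mul_mem_Ioo v (h.mem_Ioo hn v 0))
    (orient_mul_mem_Ioo v (h.mem_Ioo hn v.nbr₁ 0)) e'
  rcases v.orient_eq with e | e <;> rw [e] at e2 <;> linarith

theorem IsFoldingAngles.nbr₂_eq (h : P.IsFoldingAngles R γ) (ho : P.IsOrigami R b)
    (hn : Nondegenerate γ) (v : Vertex) : γ v.nbr₂ 1 = γ v 1 := by
  have e := h.across₂_eq v.nbr₂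
  rw [v.across₂_nbr₂, P.foldRot_nbr₂, h.across₂_eq v] at e
  have e' := congrArg ((R .inner)ᵀ * ·) e
  simp only [← Matrix.mul_assoc, ho.transpose_mul, Matrix.one_mul] at e'
  have e2 := foldRot_injective (orient_mul_mem_Ioo v (h.mem_Ioo hn v 1))
    (orient_mul_mem_Ioo v (h.mem_Ioo hn v.nbr₂ 1)) e'
  rcases v.orient_eq with e | e <;> rw [e] at e2 <;> linarith

theorem IsFoldingAngles.vertex (h : P.IsFoldingAngles R γ) (ho : P.IsOrigami R b)
    (hn : Nondegenerate γ) (hf : FollowsAssignment σ γ) (hα : ∀ v, α v ∈ Ioo 0 π)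
    (hβ : ∀ v, β v ∈ Ioo 0 π) (hσ : ∀ v, σ v ∈ MV (α v) (β v)) (v : Vertex) :
    γ v 2 = -σ v * γ v 0 ∧ γ v 3 = σ v * γ v 1 ∧
      tan (γ v 0 / 2) = -mu₂ (σ v) (α v) (β v) * tan (γ v 1 / 2) :=
  half_angles_of_assignment (hα v) (hβ v) (hσ v) (h.closed ho v) (h.mem_Ioo hn v 0)
    (h.mem_Ioo hn v 1) (h.mem_Ioo hn v 2) (h.mem_Ioo hn v 3) (hf v).1 (hf v).2

theorem tan_half_ne_zero {γ : ℝ} (h : sin γ ≠ 0) : tan (γ / 2) ≠ 0 := by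
  have e : sin γ = 2 * sin (γ / 2) * cos (γ / 2) := by
    rw [← sin_two_mul]
    congr 1
    ring
  rw [tan_eq_sin_div_cos]
  rw [e] at h
  exact div_ne_zero (right_ne_zero_of_mul (left_ne_zero_of_mul h)) (right_ne_zero_of_mul h)

/-- The compatibility condition around the panel. -/
theorem IsFoldingAngles.compatible (h : P.IsFoldingAngles R γ) (ho : P.IsOrigami R b)
    (hn : Nondegenerate γ) (hf : FollowsAssignment σ γ) (hα : ∀ v, α v ∈ Ioo 0 π)
    (hβ : ∀ v, β v ∈ Ioo 0 π) (hσ : ∀ v, σ v ∈ MV (α v) (β v)) :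
    mu₂ (σ .a) (α .a) (β .a) * mu₂ (σ .d) (α .d) (β .d) =
      mu₂ (σ .b) (α .b) (β .b) * mu₂ (σ .c) (α .c) (β .c) := by
  have hv v := (h.vertex ho hn hf hα hβ hσ v).2.2
  have ha := hv .a
  have hb := hv .b
  have hc := hv .c
  have hd := hv .d
  have e1 : γ .c 0 = γ .a 0 := h.nbr₁_eq ho hn .a
  have e2 : γ .d 0 = γ .b 0 := h.nbr₁_eq ho hn .b
  have e3 : γ .b 1 = γ .a 1 := h.nbr₂_eq ho hn .a
  have e4 : γ .d 1 = γ .c 1 := h.nbr₂_eq ho hn .c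
  rw [e3] at hb
  rw [e1] at hc
  rw [e2, e4] at hd
  have n (v) : sin (γ v 1) ≠ 0 :=
    right_ne_zero_of_mul (left_ne_zero_of_mul (left_ne_zero_of_mul (hn v)))
  -- Let `A`, `C` be the half-angle tangents at `ab`, `cd` and `m` the multipliers. The common
  -- angles at `ac` and `bd` give `m a * A = m c * C` and `m b * A = m d * C`; cross-multiply and
  -- cancel `A * C`.
  apply mul_right_cancel₀ (mul_ne_zero (tan_half_ne_zero (n .a)) (tan_half_ne_zero (n .c)))
  linear_combination tan (γ .b 0 / 2) * hc - tan (γ .b 0 / 2) * ha +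
    mu₂ (σ .a) (α .a) (β .a) * tan (γ .a 1 / 2) * hd -
    mu₂ (σ .c) (α .c) (β .c) * tan (γ .c 1 / 2) * hb

end Necessity

/-! ### Deformations with prescribed folding angles. -/

section Construction

/-- The rotations of the panels with prescribed folding angles, where the inner panel is kept
fixed. -/
noncomputable def rot (γ : Vertex → Fin 4 → ℝ) : Panel → Matrix (Fin 3) (Fin 3) ℝ
  | .inner => 1
  | .ac => foldRot (P.θ .a 0) (-(Vertex.orient .a * γ .a 0))
  | .bd => foldRot (P.θ .b 0) (-(Vertex.orient .b * γ .b 0))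
  | .ab => foldRot (P.θ .a 1) (Vertex.orient .a * γ .a 1)
  | .cd => foldRot (P.θ .c 1) (Vertex.orient .c * γ .c 1)
  | .corner v => foldRot (P.θ v 1) (v.orient * γ v 1) * foldRot (P.θ v 2) (v.orient * γ v 2)

/-- A vertex of a panel. -/
def _root_.Origami.Panel.vertex : Panel → Vertex
  | .inner => .a
  | .ac => .a
  | .bd => .b
  | .ab => .a
  | .cd => .c
  | .corner v => v

/-- The translations that belong to `rot`. -/
noncomputable def shift (γ : Vertex → Fin 4 → ℝ) (p : Panel) : Fin 3 → ℝ :=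
  P.x p.vertex - P.rot γ p *ᵥ P.x p.vertex

theorem continuous_rot (p : Panel) : Continuous fun γ => P.rot γ p := by
  have h (θ o : ℝ) (v : Vertex) (i : Fin 4) :
      Continuous fun γ : Vertex → Fin 4 → ℝ => foldRot θ (o * γ v i) :=
    (continuous_foldRot θ).comp (by fun_prop)
  have h' (θ o : ℝ) (v : Vertex) (i : Fin 4) :
      Continuous fun γ : Vertex → Fin 4 → ℝ => foldRot θ (-(o * γ v i)) :=
    (continuous_foldRot θ).comp (by fun_prop)
  cases p
  · exact continuous_const
  · exact h' _ _ _ _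
  · exact h' _ _ _ _
  · exact h _ _ _ _
  · exact h _ _ _ _
  · exact (h _ _ _ _).matrix_mul (h _ _ _ _)

theorem continuous_shift (p : Panel) : Continuous fun γ => P.shift γ p :=
  continuous_const.sub ((P.continuous_rot p).matrix_mulVec continuous_const)

variable {P} {γ : Vertex → Fin 4 → ℝ}

theorem rot_across₁ (h₁ : ∀ v : Vertex, γ v.nbr₁ 0 = γ v 0) (v : Vertex) :
    P.rot γ v.across₁ = foldRot (P.θ v 0) (-(v.orient * γ v 0)) := by
  have key (v : Vertex) : foldRot (P.θ v.nbr₁ 0) (-(v.nbr₁.orient * γ v.nbr₁ 0)) =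
      foldRot (P.θ v 0) (-(v.orient * γ v 0)) := by
    rw [h₁, ← mul_neg, ← mul_neg, P.foldRot_nbr₁]
  cases v
  · rfl
  · rfl
  · exact key .c
  · exact key .d

theorem rot_across₂ (h₂ : ∀ v : Vertex, γ v.nbr₂ 1 = γ v 1) (v : Vertex) :
    P.rot γ v.across₂ = foldRot (P.θ v 1) (v.orient * γ v 1) := by
  have key (v : Vertex) : foldRot (P.θ v.nbr₂ 1) (v.nbr₂.orient * γ v.nbr₂ 1) =
      foldRot (P.θ v 1) (v.orient * γ v 1) := by
    rw [h₂, P.foldRot_nbr₂]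
  cases v
  · rfl
  · exact key .b
  · rfl
  · exact key .d

/-- At each vertex three crease relations are built into `rot`, given that the angles match along
the sides; the fourth is the closing condition `hc`. -/
theorem isFoldingAngles_rot (h₁ : ∀ v : Vertex, γ v.nbr₁ 0 = γ v 0)
    (h₂ : ∀ v : Vertex, γ v.nbr₂ 1 = γ v 1) (hγ : ∀ v i, γ v i ∈ Icc (-π) π)
    (hc : ∀ v, foldRot 0 (γ v 0) * foldRot (α v) (γ v 1) * foldRot (α v + β v) (γ v 2) *
      foldRot (π + β v) (γ v 3) = 1) : P.IsFoldingAngles (P.rot γ) γ := by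
  refine fun v i => ⟨hγ v i, ?_⟩
  fin_cases i
  · change 1 = P.rot γ v.across₁ * _
    rw [rot_across₁ h₁]
    exact (foldRot_neg_mul _ _).symm
  · change P.rot γ v.across₂ = 1 * _
    rw [rot_across₂ h₂, Matrix.one_mul]
    rfl
  · change P.rot γ (.corner v) = P.rot γ v.across₂ * _
    rw [rot_across₂ h₂]
    rfl
  · change P.rot γ v.across₁ = P.rot γ (.corner v) * foldRot (P.θ v 3) (v.orient * γ v 3)
    have h := (P.closed_iff v (γ v)).2 (hc v)
    rw [rot_across₁ h₁, rot]
    have h' := congrArg (foldRot (P.θ v 0) (-(v.orient * γ v 0)) * ·) h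
    simpa only [← Matrix.mul_assoc, foldRot_neg_mul, Matrix.one_mul, Matrix.mul_one] using h'.symm

theorem rot_mem (γ : Vertex → Fin 4 → ℝ) (p : Panel) :
    P.rot γ p ∈ specialOrthogonalGroup (Fin 3) ℝ := by
  cases p
  · exact one_mem _
  · exact foldRot_mem _ _
  · exact foldRot_mem _ _
  · exact foldRot_mem _ _
  · exact foldRot_mem _ _
  · exact mul_mem (foldRot_mem _ _) (foldRot_mem _ _)

theorem rot_mulVec_add_shift_across {γ : Vertex → Fin 4 → ℝ} {p : Panel} {θ l γ' : ℝ}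
    {y : Fin 3 → ℝ} (hp : P.rot γ p = foldRot θ γ') (hy : y = P.x p.vertex + l • dir θ) :
    P.rot γ p *ᵥ y + P.shift γ p = y := by
  rw [shift, hy, mulVec_add, mulVec_smul, hp, foldRot_mulVec_dir]
  abel

theorem rot_mulVec_add_shift (γ : Vertex → Fin 4 → ℝ) (p : Panel) :
    P.rot γ p *ᵥ P.x p.vertex + P.shift γ p = P.x p.vertex := by
  rw [shift, add_sub_cancel]

/-- The constructed deformation fixes the vertices of the inner panel. -/
theorem rot_mulVec_add_shift_panelAt (γ : Vertex → Fin 4 → ℝ) (v : Vertex) (i : Fin 4) :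
    P.rot γ (panelAt v i) *ᵥ P.x v + P.shift γ (panelAt v i) = P.x v := by
  fin_cases i
  · change (1 : Matrix (Fin 3) (Fin 3) ℝ) *ᵥ P.x v +
      (P.x .a - (1 : Matrix (Fin 3) (Fin 3) ℝ) *ᵥ P.x .a) = P.x v
    simp
  · change P.rot γ v.across₂ *ᵥ P.x v + P.shift γ v.across₂ = P.x v
    cases v
    · exact rot_mulVec_add_shift γ .ab
    · exact rot_mulVec_add_shift_across (p := .ab) rfl (P.side₂ .a)
    · exact rot_mulVec_add_shift γ .cd
    · exact rot_mulVec_add_shift_across (p := .cd) rfl (P.side₂ .c)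
  · exact rot_mulVec_add_shift γ (.corner v)
  · change P.rot γ v.across₁ *ᵥ P.x v + P.shift γ v.across₁ = P.x v
    cases v
    · exact rot_mulVec_add_shift γ .ac
    · exact rot_mulVec_add_shift γ .bd
    · exact rot_mulVec_add_shift_across (p := .ac) rfl (P.side₁ .a)
    · exact rot_mulVec_add_shift_across (p := .bd) rfl (P.side₁ .b)

/-- All panels around `v` leave `P.x v` fixed, and a fold fixes the direction of its crease, so
adjacent panels agree along the whole crease. -/
theorem isOrigami_rot (h : P.IsFoldingAngles (P.rot γ) γ) :
    P.IsOrigami (P.rot γ) (P.shift γ) := by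
  refine ⟨rot_mem γ, fun v i y hy => ?_⟩
  rw [crease, segment_eq_image'] at hy
  obtain ⟨t, -, rfl⟩ := hy
  have e : P.rot γ (panelAt v i) *ᵥ dir (P.θ v i) =
      P.rot γ (panelAt v (i - 1)) *ᵥ dir (P.θ v i) := by
    rw [(h v i).2, ← mulVec_mulVec, foldRot_mulVec_dir]
  simp only [add_sub_cancel_left, mulVec_add, mulVec_smul, e]
  rw [add_right_comm, rot_mulVec_add_shift_panelAt, add_right_comm, rot_mulVec_add_shift_panelAt]

end Construction

/-! ### Uniqueness up to rigid motion. -/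

section Uniqueness

variable {P} {R R' : Panel → Matrix (Fin 3) (Fin 3) ℝ} {b b' : Panel → Fin 3 → ℝ}
  {γ γ' : Vertex → Fin 4 → ℝ} {σ : Vertex → SignType}

/-- The folding angles determine the deformation gradients up to a rotation of space. -/
theorem IsFoldingAngles.eq_inner_mul_rot (h : P.IsFoldingAngles R γ) (p : Panel) :
    R p = R .inner * P.rot γ p := by
  have h₁ (v : Vertex) :
      R v.across₁ = R .inner * foldRot (P.θ v 0) (-(v.orient * γ v 0)) := by
    rw [h.inner_eq v, Matrix.mul_assoc, mul_eq_one_comm.1 (foldRot_neg_mul _ _), Matrix.mul_one]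
  cases p with
  | inner => exact (Matrix.mul_one _).symm
  | ac => exact h₁ .a
  | bd => exact h₁ .b
  | ab => exact h.across₂_eq .a
  | cd => exact h.across₂_eq .c
  | corner v => rw [h.corner_eq, h.across₂_eq, rot, Matrix.mul_assoc]

/-- This recovers the translation of each panel from its rotation and the motion of the inner panel.
-/
theorem IsOrigami.apply_vertex (ho : P.IsOrigami R b) (p : Panel) :
    R p *ᵥ P.x p.vertex + b p = R .inner *ᵥ P.x p.vertex + b .inner := by
  have key v i := ho.2 v i (P.x v) (left_mem_segment ℝ _ _)
  have h₁ (v : Vertex) : R v.across₁ *ᵥ P.x v + b v.across₁ = R .inner *ᵥ P.x v + b .inner :=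
    key v 0
  have h₂ (v : Vertex) : R .inner *ᵥ P.x v + b .inner = R v.across₂ *ᵥ P.x v + b v.across₂ :=
    key v 1
  cases p with
  | inner => rfl
  | ac => exact h₁ .a
  | bd => exact h₁ .b
  | ab => exact (h₂ .a).symm
  | cd => exact (h₂ .c).symm
  | corner v => exact (key v 2).symm.trans (h₂ v).symm

theorem exists_rigid_motion (ho : P.IsOrigami R b) (ho' : P.IsOrigami R' b')
    (h : P.IsFoldingAngles R γ) (h' : P.IsFoldingAngles R' γ) :
    ∃ Q ∈ specialOrthogonalGroup (Fin 3) ℝ, ∃ c : Fin 3 → ℝ,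
      ∀ p, R' p = Q * R p ∧ b' p = Q *ᵥ b p + c := by
  have hR (p : Panel) : R' p = R' .inner * (R .inner)ᵀ * R p := by
    rw [h.eq_inner_mul_rot p, Matrix.mul_assoc, ← Matrix.mul_assoc _ (R .inner),
      ho.transpose_mul, Matrix.one_mul]
    exact h'.eq_inner_mul_rot p
  refine ⟨R' .inner * (R .inner)ᵀ, mul_mem (ho'.1 _) ?_,
    b' .inner - (R' .inner * (R .inner)ᵀ) *ᵥ b .inner, fun p => ⟨hR p, ?_⟩⟩
  · have := mem_specialOrthogonalGroup_iff.1 (ho.1 .inner)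
    rw [mem_specialOrthogonalGroup_iff, mem_orthogonalGroup_iff', det_transpose]
    exact ⟨by simpa using (mem_orthogonalGroup_iff (Fin 3) ℝ).1 this.1, this.2⟩
  · have e := congrArg ((R' .inner * (R .inner)ᵀ) *ᵥ ·) (ho.apply_vertex p)
    have e' := ho'.apply_vertex p
    simp only [mulVec_add, mulVec_mulVec, ← hR] at e
    rw [← eq_sub_iff_add_eq'] at e'
    rw [← eq_sub_iff_add_eq'] at e
    rw [e, e']
    abel

theorem eq_of_tan_half_eq {x y : ℝ} (hx : x ∈ Ioo (-π) π) (hy : y ∈ Ioo (-π) π)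
    (h : tan (x / 2) = tan (y / 2)) : x = y := by
  have := injOn_tan (⟨by linarith [hx.1], by linarith [hx.2]⟩ : x / 2 ∈ Ioo (-(π / 2)) (π / 2))
    (⟨by linarith [hy.1], by linarith [hy.2]⟩ : y / 2 ∈ Ioo (-(π / 2)) (π / 2)) h
  linarith

/-- The angle at `ac` determines those at `ab` (through `a`) and `cd` (through `c`), and then the
one at `bd`; nonzero multipliers and the injectivity of the tangent carry each step. The outer
creases follow from the sides by sign. -/
theorem uniqueAlong (hα : ∀ v, α v ∈ Ioo 0 π) (hβ : ∀ v, β v ∈ Ioo 0 π)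
    (hσ : ∀ v, σ v ∈ MV (α v) (β v)) : P.UniqueAlong σ := by
  intro R R' b b' γ γ' ho h hn hf ho' h' hn' hf' h0
  have hv := h.vertex ho hn hf hα hβ hσ
  have hv' := h'.vertex ho' hn' hf' hα hβ hσ
  have step₁ (v : Vertex) (e : γ v 0 = γ' v 0) : γ v 1 = γ' v 1 := by
    apply eq_of_tan_half_eq (h.mem_Ioo hn v 1) (h'.mem_Ioo hn' v 1)
    apply mul_left_cancel₀ (neg_ne_zero.2 (mu₂_ne_zero (hα v) (hβ v) (hσ v)))
    rw [← (hv v).2.2, ← (hv' v).2.2, e]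
  have step₀ (v : Vertex) (e : γ v 1 = γ' v 1) : γ v 0 = γ' v 0 := by
    apply eq_of_tan_half_eq (h.mem_Ioo hn v 0) (h'.mem_Ioo hn' v 0)
    rw [(hv v).2.2, (hv' v).2.2, e]
  have a1 := step₁ .a h0
  have b1 : γ .b 1 = γ' .b 1 :=
    (h.nbr₂_eq ho hn .a).trans (a1.trans (h'.nbr₂_eq ho' hn' .a).symm)
  have c0 : γ .c 0 = γ' .c 0 :=
    (h.nbr₁_eq ho hn .a).trans (h0.trans (h'.nbr₁_eq ho' hn' .a).symm)
  have c1 := step₁ .c c0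
  have d1 : γ .d 1 = γ' .d 1 :=
    (h.nbr₂_eq ho hn .c).trans (c1.trans (h'.nbr₂_eq ho' hn' .c).symm)
  have e0 (v : Vertex) : γ v 0 = γ' v 0 := by
    cases v
    exacts [h0, step₀ _ b1, c0, step₀ _ d1]
  have e : γ = γ' := by
    funext v i
    fin_cases i
    · exact e0 v
    · exact step₁ v (e0 v)
    · change γ v 2 = γ' v 2
      rw [(hv v).1, (hv' v).1, e0 v]
    · change γ v 3 = γ' v 3
      rw [(hv v).2.1, (hv' v).2.1, step₁ v (e0 v)]
  exact exists_rigid_motion ho ho' h (e ▸ h')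

end Uniqueness

end Pattern

/-! ### The explicit folding motion. -/

/-- The folding angle `γ` with `tan (γ / 2) = k * tan (π * s / 2)`. -/
noncomputable def foldAngle (k s : ℝ) : ℝ :=
  2 * arcsin (k * sin (π * s / 2) / √(cos (π * s / 2) ^ 2 + (k * sin (π * s / 2)) ^ 2))

theorem sq_add_sq_pos_of_foldAngle {k : ℝ} (hk : k ≠ 0) (x : ℝ) :
    0 < cos x ^ 2 + (k * sin x) ^ 2 := by
  by_cases h : sin x = 0
  · have := sin_sq_add_cos_sq x
    rw [h] at this ⊢
    nlinarith
  · positivity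

/-- The arcsine form avoids the pole of `tan (π * s / 2)` at `s = 1`, so the motion is continuous up
to the folded flat state. -/
theorem continuous_foldAngle {k : ℝ} (hk : k ≠ 0) : Continuous (foldAngle k) := by
  have h (s : ℝ) : √(cos (π * s / 2) ^ 2 + (k * sin (π * s / 2)) ^ 2) ≠ 0 :=
    (sqrt_pos.2 (sq_add_sq_pos_of_foldAngle hk _)).ne'
  exact continuous_const.mul (continuous_arcsin.comp (Continuous.div (by fun_prop) (by fun_prop) h))

theorem foldAngle_mem (k s : ℝ) : foldAngle k s ∈ Icc (-π) π := by
  have h1 := neg_pi_div_two_le_arcsin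
    (k * sin (π * s / 2) / √(cos (π * s / 2) ^ 2 + (k * sin (π * s / 2)) ^ 2))
  have h2 := arcsin_le_pi_div_two
    (k * sin (π * s / 2) / √(cos (π * s / 2) ^ 2 + (k * sin (π * s / 2)) ^ 2))
  unfold foldAngle
  constructor <;> linarith

theorem sin_half_foldAngle {k : ℝ} (hk : k ≠ 0) (s : ℝ) :
    sin (foldAngle k s / 2) =
      k * sin (π * s / 2) / √(cos (π * s / 2) ^ 2 + (k * sin (π * s / 2)) ^ 2) := by
  have h := sq_add_sq_pos_of_foldAngle hk (π * s / 2)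
  rw [foldAngle, mul_div_cancel_left₀ _ two_ne_zero]
  have : |k * sin (π * s / 2) / √(cos (π * s / 2) ^ 2 + (k * sin (π * s / 2)) ^ 2)| ≤ 1 := by
    rw [abs_div, abs_of_pos (sqrt_pos.2 h), div_le_one (sqrt_pos.2 h)]
    exact abs_le_sqrt (le_add_of_nonneg_left (sq_nonneg _))
  exact sin_arcsin (abs_le.1 this).1 (abs_le.1 this).2

theorem cos_half_foldAngle {k s : ℝ} (hk : k ≠ 0) (hs : s ∈ Icc (0 : ℝ) 1) :
    cos (foldAngle k s / 2) =
      cos (π * s / 2) / √(cos (π * s / 2) ^ 2 + (k * sin (π * s / 2)) ^ 2) := by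
  have h := sq_add_sq_pos_of_foldAngle hk (π * s / 2)
  have hc : 0 ≤ cos (π * s / 2) :=
    cos_nonneg_of_mem_Icc ⟨by nlinarith [hs.1, pi_pos], by nlinarith [hs.2, pi_pos]⟩
  rw [foldAngle, mul_div_cancel_left₀ _ two_ne_zero, cos_arcsin, div_pow, sq_sqrt h.le,
    one_sub_div h.ne', add_sub_cancel_right, sqrt_div (sq_nonneg _), sqrt_sq hc]

theorem foldAngle_zero (k : ℝ) : foldAngle k 0 = 0 := by
  simp [foldAngle]

theorem abs_foldAngle_one {k : ℝ} (hk : k ≠ 0) : |foldAngle k 1| = π := by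
  have e : foldAngle k 1 = 2 * arcsin (k / |k|) := by
    simp [foldAngle, sqrt_sq_eq_abs]
  rw [e]
  rcases lt_or_gt_of_ne hk with h | h
  · rw [abs_of_neg h, div_neg, div_self hk, arcsin_neg_one, mul_neg, abs_neg,
      mul_div_cancel₀ _ two_ne_zero, abs_of_pos pi_pos]
  · rw [abs_of_pos h, div_self hk, arcsin_one, mul_div_cancel₀ _ two_ne_zero, abs_of_pos pi_pos]

theorem sin_foldAngle_ne_zero {k s : ℝ} (hk : k ≠ 0) (hs : s ∈ Ioo (0 : ℝ) 1) :
    sin (foldAngle k s) ≠ 0 := by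
  have h := sqrt_pos.2 (sq_add_sq_pos_of_foldAngle hk (π * s / 2))
  have hc : 0 < cos (π * s / 2) :=
    cos_pos_of_mem_Ioo ⟨by nlinarith [hs.1, pi_pos], by nlinarith [hs.2, pi_pos]⟩
  have hs' : 0 < sin (π * s / 2) :=
    sin_pos_of_pos_of_lt_pi (by nlinarith [hs.1, pi_pos]) (by nlinarith [hs.2, pi_pos])
  rw [show foldAngle k s = 2 * (foldAngle k s / 2) by ring, sin_two_mul,
    sin_half_foldAngle hk, cos_half_foldAngle hk ⟨hs.1.le, hs.2.le⟩]
  have := hs'.ne'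
  positivity

theorem sin_half_foldAngle_mul_cos {k k' m s : ℝ} (hk : k ≠ 0) (hk' : k' ≠ 0)
    (hs : s ∈ Icc (0 : ℝ) 1) (h : k = m * k') :
    sin (foldAngle k s / 2) * cos (foldAngle k' s / 2) =
      m * (sin (foldAngle k' s / 2) * cos (foldAngle k s / 2)) := by
  rw [sin_half_foldAngle hk, sin_half_foldAngle hk', cos_half_foldAngle hk hs,
    cos_half_foldAngle hk' hs, div_mul_div_comm, div_mul_div_comm]
  nth_rw 1 [h]
  ring

theorem sign_sign_mul {σ : SignType} (x : ℝ) :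
    SignType.sign ((σ : ℝ) * x) = σ * SignType.sign x := by
  rw [sign_mul]
  congr 1
  cases σ <;> simp

namespace Pattern

variable {α β : Vertex → ℝ} {σ : Vertex → SignType}

/-- The compatibility condition around the panel suffices. -/
theorem foldsAlong (P : Pattern α β) (hα : ∀ v, α v ∈ Ioo 0 π) (hβ : ∀ v, β v ∈ Ioo 0 π)
    (hσ : ∀ v, σ v ∈ MV (α v) (β v))
    (h : mu₂ (σ .a) (α .a) (β .a) * mu₂ (σ .d) (α .d) (β .d) =
      mu₂ (σ .b) (α .b) (β .b) * mu₂ (σ .c) (α .c) (β .c)) : P.FoldsAlong σ := by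
  set m : Vertex → ℝ := fun v => mu₂ (σ v) (α v) (β v) with hm
  have hm0 v : m v ≠ 0 := mu₂_ne_zero (hα v) (hβ v) (hσ v)
  replace h : m .a * m .d = m .b * m .c := h
  -- The slopes are normalized so that `k₀ = 1` on `ac`, whose angle is then `π * s`. Sharing `k₁`
  -- along `ab` and `cd` gives `k₀ b = m b / m a` and `k₀ d = m d / m c`, and these agree exactly by
  -- the compatibility condition.
  let k₁ : Vertex → ℝ := Vertex.vals (-(m .a)⁻¹) (-(m .a)⁻¹) (-(m .c)⁻¹) (-(m .c)⁻¹)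
  let k₀ : Vertex → ℝ := fun v => -m v * k₁ v
  have hk₁ v : k₁ v ≠ 0 := by
    have := hm0 .a
    have := hm0 .c
    cases v <;> simpa [k₁, Vertex.vals]
  have hk₀ v : k₀ v ≠ 0 := mul_ne_zero (neg_ne_zero.2 (hm0 v)) (hk₁ v)
  have hac : k₀ .c = k₀ .a := by
    have := hm0 .a
    have := hm0 .c
    simp only [k₀, k₁, Vertex.vals]
    field_simp
  have hbd : k₀ .d = k₀ .b := by
    have := hm0 .a
    have := hm0 .c
    simp only [k₀, k₁, Vertex.vals]
    field_simp
    linear_combination h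
  have hn₀ (v : Vertex) : k₀ v.nbr₁ = k₀ v := by
    cases v
    exacts [hac, hbd, hac.symm, hbd.symm]
  have hn₁ (v : Vertex) : k₁ v.nbr₂ = k₁ v := by cases v <;> rfl
  let γ (s : ℝ) (v : Vertex) : Fin 4 → ℝ := ![foldAngle (k₀ v) s, foldAngle (k₁ v) s,
    -σ v * foldAngle (k₀ v) s, σ v * foldAngle (k₁ v) s]
  have hσ' v : σ v = 1 ∨ σ v = -1 := (mu₂_data (hα v) (hβ v) (hσ v)).1
  have hγ : Continuous γ := by
    have c₀ v := continuous_foldAngle (hk₀ v)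
    have c₁ v := continuous_foldAngle (hk₁ v)
    refine continuous_pi fun v => continuous_pi fun i => ?_
    fin_cases i
    · exact c₀ v
    · exact c₁ v
    · exact continuous_const.mul (c₀ v)
    · exact continuous_const.mul (c₁ v)
  have hmem (s : ℝ) (v : Vertex) (i : Fin 4) : γ s v i ∈ Icc (-π) π := by
    have h0 := foldAngle_mem (k₀ v) s
    have h1 := foldAngle_mem (k₁ v) s
    have hneg {x : ℝ} (hx : x ∈ Icc (-π) π) : -x ∈ Icc (-π) π :=
      ⟨by linarith [hx.2], by linarith [hx.1]⟩
    rcases hσ' v with e | e <;> fin_cases i <;> simp [γ, e, -mem_Icc] <;>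
      first | assumption | (apply hneg; assumption)
  have hfold (s : ℝ) (hs : s ∈ Icc (0 : ℝ) 1) : P.IsFoldingAngles (P.rot (γ s)) (γ s) := by
    refine isFoldingAngles_rot (fun v => ?_) (fun v => ?_) (hmem s) fun v => ?_
    · change foldAngle (k₀ v.nbr₁) s = foldAngle (k₀ v) s
      rw [hn₀]
    · change foldAngle (k₁ v.nbr₂) s = foldAngle (k₁ v) s
      rw [hn₁]
    · exact closed_of_half_angles (hα v) (hβ v) (hσ v)
        (sin_half_foldAngle_mul_cos (hk₀ v) (hk₁ v) hs rfl)
  refine ⟨fun s => P.rot (γ s), fun s => P.shift (γ s), γ, ?_, ?_, hγ.continuousOn,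
    fun s hs => ⟨isOrigami_rot (hfold s hs), hfold s hs⟩, ?_, ?_, ?_⟩
  · exact (continuous_pi fun p => (P.continuous_rot p).comp hγ).continuousOn
  · exact (continuous_pi fun p => (P.continuous_shift p).comp hγ).continuousOn
  · intro v i
    fin_cases i <;> simp [γ, foldAngle_zero]
  · intro v i
    have h0 := abs_foldAngle_one (hk₀ v)
    have h1 := abs_foldAngle_one (hk₁ v)
    rcases hσ' v with e | e <;> fin_cases i <;> simp [γ, e, h0, h1]
  · intro s hs
    refine ⟨fun v => ?_, fun v => ⟨?_, sign_sign_mul _⟩⟩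
    · have h0 := sin_foldAngle_ne_zero (hk₀ v) hs
      have h1 := sin_foldAngle_ne_zero (hk₁ v) hs
      rcases hσ' v with e | e <;> simp [γ, e, h0, h1]
    · change SignType.sign (-(σ v : ℝ) * foldAngle (k₀ v) s) = _
      rw [← SignType.coe_neg]
      exact sign_sign_mul _

theorem FoldsAlong.compatible {P : Pattern α β} (h : P.FoldsAlong σ)
    (hα : ∀ v, α v ∈ Ioo 0 π) (hβ : ∀ v, β v ∈ Ioo 0 π) (hσ : ∀ v, σ v ∈ MV (α v) (β v)) :
    mu₂ (σ .a) (α .a) (β .a) * mu₂ (σ .d) (α .d) (β .d) =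
      mu₂ (σ .b) (α .b) (β .b) * mu₂ (σ .c) (α .c) (β .c) := by
  obtain ⟨R, b, γ, -, -, -, ho, -, -, hn⟩ := h
  -- A single intermediate state already forces the condition.
  have h1 : (1 / 2 : ℝ) ∈ Ioo (0 : ℝ) 1 := by norm_num
  have h2 := ho (1 / 2) ⟨h1.1.le, h1.2.le⟩
  exact h2.2.compatible h2.1 (hn _ h1).1 (hn _ h1).2 hα hβ hσ

end Pattern

end Origami

theorem mainTheorem1
    (αa αb αc βa βb βc : ℝ) (σa σb σc : SignType)
    (hαa : αa ∈ Set.Ioo 0 Real.pi) (hαb : αb ∈ Set.Ioo 0 Real.pi) (hαc : αc ∈ Set.Ioo 0 Real.pi)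
    (hαd : 2 * Real.pi - αa - αb - αc ∈ Set.Ioo 0 Real.pi)
    (hβa : βa ∈ Set.Ioo 0 Real.pi) (hβb : βb ∈ Set.Ioo 0 Real.pi) (hβc : βc ∈ Set.Ioo 0 Real.pi)
    (ha : (αa, βa) ≠ (Real.pi / 2, Real.pi / 2)) (hb : (αb, βb) ≠ (Real.pi / 2, Real.pi / 2))
    (hc : (αc, βc) ≠ (Real.pi / 2, Real.pi / 2))
    (hσa : σa ∈ Origami.MV αa βa) (hσb : σb ∈ Origami.MV αb βb) (hσc : σc ∈ Origami.MV αc βc)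
    (αd μ : ℝ) (hd : αd = 2 * Real.pi - αa - αb - αc)
    (hμ : μ = Origami.mu₁ (-σa) αa βa * Origami.mu₂ σb αb βb * Origami.mu₂ σc αc βc) :
    (|μ| = 1 →
      ∀ βd ∈ Set.Ioo 0 Real.pi, ∀ σd ∈ Origami.MV αd βd,
        ∀ P : Origami.Pattern (Origami.Vertex.vals αa αb αc αd)
            (Origami.Vertex.vals βa βb βc βd),
          ¬ P.FoldsAlong (Origami.Vertex.vals σa σb σc σd)) ∧
    (|μ| ≠ 1 →
      ∃ (βd : ℝ) (σd : SignType),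
        βd ∈ Set.Ioo 0 Real.pi ∧ σd ∈ Origami.MV αd βd ∧
        σd = -SignType.sign (μ ^ 2 - 1) ∧
        βd = Real.arccos ((σd : ℝ) *
          ((2 * μ - (μ ^ 2 + 1) * Real.cos (αa + αb + αc)) /
            (2 * μ * Real.cos (αa + αb + αc) - (μ ^ 2 + 1)))) ∧
        -- patterns with these angles exist, and all of them fold, in a unique way
        Nonempty (Origami.Pattern (Origami.Vertex.vals αa αb αc αd)
          (Origami.Vertex.vals βa βb βc βd)) ∧
        (∀ P : Origami.Pattern (Origami.Vertex.vals αa αb αc αd)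
            (Origami.Vertex.vals βa βb βc βd),
          P.FoldsAlong (Origami.Vertex.vals σa σb σc σd) ∧
          P.UniqueAlong (Origami.Vertex.vals σa σb σc σd)) ∧
        -- no other pair gives a pattern that folds
        ∀ βd' ∈ Set.Ioo 0 Real.pi, ∀ σd' ∈ Origami.MV αd βd',
          (∃ P : Origami.Pattern (Origami.Vertex.vals αa αb αc αd)
              (Origami.Vertex.vals βa βb βc βd'),
            P.FoldsAlong (Origami.Vertex.vals σa σb σc σd')) →
          βd' = βd ∧ σd' = σd) := by
  have hd' : αd ∈ Set.Ioo 0 Real.pi := hd ▸ hαd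
  have hma := Origami.mu₂_ne_zero hαa hβa hσa
  have hmb := Origami.mu₂_ne_zero hαb hβb hσb
  have hmc := Origami.mu₂_ne_zero hαc hβc hσc
  rw [Origami.mu₁_neg_eq_inv hαa hβa hσa] at hμ
  have hμ0 : μ ≠ 0 := by
    rw [hμ]
    exact mul_ne_zero (mul_ne_zero (inv_ne_zero hma) hmb) hmc
  -- Thus `μ` is precisely the multiplier that the compatibility condition requires at `d`.
  have hμ' : Origami.mu₂ σa αa βa * μ = Origami.mu₂ σb αb βb * Origami.mu₂ σc αc βc := by
    rw [hμ]
    field_simp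
  have hα : ∀ v, Origami.Vertex.vals αa αb αc αd v ∈ Set.Ioo 0 Real.pi := by
    rintro (_ | _ | _ | _) <;> assumption
  have hβ {βd : ℝ} (h : βd ∈ Set.Ioo 0 Real.pi) :
      ∀ v, Origami.Vertex.vals βa βb βc βd v ∈ Set.Ioo 0 Real.pi := by
    rintro (_ | _ | _ | _) <;> assumption
  have hσ {βd : ℝ} {σd : SignType} (h : σd ∈ Origami.MV αd βd) :
      ∀ v, Origami.Vertex.vals σa σb σc σd v ∈
        Origami.MV (Origami.Vertex.vals αa αb αc αd v) (Origami.Vertex.vals βa βb βc βd v) := by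
    rintro (_ | _ | _ | _) <;> assumption
  have key {βd : ℝ} {σd : SignType} (h : βd ∈ Set.Ioo 0 Real.pi) (h' : σd ∈ Origami.MV αd βd)
      (P : Origami.Pattern (Origami.Vertex.vals αa αb αc αd)
        (Origami.Vertex.vals βa βb βc βd))
      (hP : P.FoldsAlong (Origami.Vertex.vals σa σb σc σd)) : Origami.mu₂ σd αd βd = μ := by
    apply mul_left_cancel₀ hma
    rw [hμ']
    exact hP.compatible hα (hβ h) (hσ h')
  have hcos : Real.cos (αa + αb + αc) = Real.cos αd := by
    rw [hd, ← Real.cos_two_pi_sub]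
    congr 1
    ring
  rw [hcos]
  refine ⟨fun h1 βd hβd σd hσd P hP => ?_, fun h1 => ?_⟩
  · rw [← key hβd hσd P hP] at h1
    exact (Origami.eq_of_mu₂ hd' hβd hσd).1 h1
  · obtain ⟨βd, hβd, σd, hσd, e⟩ := Origami.exists_mu₂_eq hd' hμ0 h1
    obtain ⟨-, e1, e2⟩ := Origami.eq_of_mu₂ hd' hβd hσd
    rw [e] at e1 e2
    refine ⟨βd, σd, hβd, hσd, e1, e2, Origami.nonempty_pattern hα hd, fun P =>
      ⟨P.foldsAlong hα (hβ hβd) (hσ hσd) ?_, Origami.Pattern.uniqueAlong hα (hβ hβd) (hσ hσd)⟩,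
      fun βd' hβd' σd' hσd' ⟨P, hP⟩ => ?_⟩
    · change _ * Origami.mu₂ σd αd βd = _
      rw [e]
      exact hμ'
    · obtain ⟨-, e1', e2'⟩ := Origami.eq_of_mu₂ hd' hβd' hσd'
      rw [key hβd' hσd' P hP] at e1' e2'
      have e3 : σd' = σd := e1'.trans e1.symm
      exact ⟨by rw [e2', e2, e3], e3⟩
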